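/- Let $n\ge 6$, $\theta>0$, and let $A=(a_{i,j})_{i,j=1}^n$ be a real array with $a_{i,j}=a_{j,i}$. Let $\pi$ be a random permutation of $[n]$ with the Ewens distribution, $P(\pi=\sigma)=\theta^{\#(\sigma)}/\big(\theta(\theta+1)\cdots(\theta+n-1)\big)$, where $\#(\sigma)$ is the number of cycles of $\sigma$. Write $x_{(k)}=x(x-1)\cdots(x-k+1)$ and put $$a_{\bullet,\bullet}=\frac{\theta\sum_i a_{i,i}+\sum_{i\ne j}a_{i,j}}{n(\theta+n-1)},\qquad \widehat a_{i,j}=a_{i,j}-a_{\bullet,\bullet},\qquad M=\max_{i,j}|\widehat a_{i,j}|,\qquad c=20M,$$ $$S=\sum_{i=1}^n a_{i,\pi(i)},\qquad Y=S-\mathbb E S,\qquad \sigma^2=\operatorname{Var}(S),\qquad \lambda=\frac4n,$$ and assume $\sigma^2>0$. Let $|i|$ be the length of the cycle of $\pi$ containing $i$, let $c_1$ be the number of fixed points of $\pi$, and let $$T=2\big(n+c_1-2(\theta+1)\big)\sum_{|i|=1}\widehat a_{i,i}+2(c_1-2\theta)\sum_{|i|\ge2}\widehat a_{i,i}-4\sum_{|i|=|j|=1,\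 j\ne i}\widehat a_{i,j}-4\sum_{|i|=1,\ |j|\ge2}\widehat a_{i,j},\qquad R=\frac{\mathbb E[T\mid Y]}{n(n-1)}.$$ This is the remainder in the approximate Stein pair equation: if $(I,J)$ is uniform on the ordered pairs of distinct indices and independent of $\pi$, $\tau_{I,J}$ is the transposition of $I$ and $J$, $\pi''=\tau_{I,J}\pi\tau_{I,J}$ and $Y''=\sum_i a_{i,\pi''(i)}-\mathbb E S$, then $\mathbb E[Y''\mid Y]=(1-\lambda)Y+R$ almost surely. For real $\alpha$ let $B_1(\alpha)=\mathbb E|R|/\lambda$ if $|R|$ and $e^{sY}$ are negatively correlated (that is, $\operatorname{Cov}(|R|,e^{sY})\le0$) for all $0<s<\alpha$, and $B_1(\alpha)=\operatorname{ess\,sup}|\mathbb E[R\mid Y]|/\lambda$ otherwise. Let $B_2=|\mathbb E(YR)|/\lambda$. For $t\in\mathbb R$ put $x=t-\mathbb E|R|/\lambda$, and let $\alpha_t=(\log x-\log\log x)/c$ if $x>1$ and $\alpha_t=0$ otherwise. Then: (a) For all $t>0$, with $B_1=B_1(1/c)$, $$P(Y\ge t)\le\exp\left(-\frac{t(t-2B_1)}{2(\sigma^2+B_2+ct)}\right),$$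 and, with $B_1=B_1(2/c)$, $$P(Y\ge t)\le\exp\left(-\frac{t(t-2B_1)}{10(\sigma^2+B_2)/3+ct}\right).$$ (b) With $B_1=B_1(\alpha_t)$, for all $t>B_1$, $$P(Y\ge t)\le\exp\left(-\frac{t-B_1}{2c}\left(\log(t-B_1)-\frac{2(\sigma^2+B_2)}{c}\right)\right),$$ and for all $t>B_1+e$, $$P(Y\ge t)\le\exp\left(-\frac{t-B_1}{c}\left(\log(t-B_1)-\log\log(t-B_1)-\frac{\sigma^2+B_2}{c}\right)\right)\le\exp\left(-\frac{t-B_1}{2c}\left(\log(t-B_1)-\frac{2(\sigma^2+B_2)}{c}\right)\right).$$ The same bounds hold for the left tail $P(Y\le-t)$, where $B_1(\alpha)$ is now formed with $(-Y,-R)$ in place of $(Y,R)$. Moreover, for every $\alpha$ and for both tails, $B_1(\alpha)\le(6n+4.8\theta)M$, and $$B_2\le\left(3\kappa_1+1.2\,\theta+\frac{1.2(\kappa_1(\theta+1)+\kappa_2)}{n}\right)M\sigma,$$ where $$\kappa_1=\sqrt{\frac{\theta^2n_{(2)}}{(\theta+n-1)_{(2)}}+\frac{\theta n}{\theta+n-1}},\qquad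 \kappa_2=\sqrt{\frac{\theta^4n_{(4)}}{(\theta+n-1)_{(4)}}+\frac{4\theta^3n_{(3)}}{(\theta+n-1)_{(3)}}+\frac{2\theta^2n_{(2)}}{(\theta+n-1)_{(2)}}}.$$ If $|R|$ and $e^{sY}$ (respectively $e^{-sY}$, for the left tail) are negatively correlated for all $0<s<\alpha$, then $$B_1(\alpha)\le\frac{\theta M(3.6n+2.4\theta-3)}{\theta+n-1}+\frac{\theta^2nM}{2(\theta+n-1)_{(2)}}.$$ -/

import Mathlib

open MeasureTheory ProbabilityTheory

noncomputable section

/-! ### The Ewens distribution -/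

/-- The number of cycles of a permutation, fixed points included. -/
def numCycles {n : ℕ} (σ : Equiv.Perm (Fin n)) : ℕ :=
  Multiset.card σ.partition.parts

/-- The Ewens probability `θ ^ #(σ) / (θ (θ + 1) ⋯ (θ + n - 1))` of the permutation `σ`. -/
def ewensProb {n : ℕ} (θ : ℝ) (σ : Equiv.Perm (Fin n)) : ℝ :=
  θ ^ numCycles σ / (ascPochhammer ℝ n).eval θ

/-- The random permutation `π` has the Ewens distribution with parameter `θ`. -/
def HasEwensLaw {Ω : Type*} [MeasurableSpace Ω] (μ : Measure Ω) {n : ℕ} (θ : ℝ)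
    (π : Ω → Equiv.Perm (Fin n)) : Prop :=
  ∀ σ, MeasurableSet {ω | π ω = σ} ∧ μ {ω | π ω = σ} = ENNReal.ofReal (ewensProb θ σ)

/-! ### Hoeffding's statistic -/

/-- Hoeffding's statistic `∑ i, a_{i, σ(i)}`. -/
def hoeffding {n : ℕ} (A : Matrix (Fin n) (Fin n) ℝ) (σ : Equiv.Perm (Fin n)) : ℝ :=
  ∑ i, A i (σ i)

/-- The weighted mean entry
`a_{••} = (θ ∑ i, a_{i,i} + ∑ i ≠ j, a_{i,j}) / (n (θ + n - 1))`. -/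
def meanEntry {n : ℕ} (θ : ℝ) (A : Matrix (Fin n) (Fin n) ℝ) : ℝ :=
  (θ * ∑ i, A i i + ∑ i, ∑ j with j ≠ i, A i j) / (n * (θ + n - 1))

/-- The centred array `a_{i,j} - a_{••}`. -/
def centredArray {n : ℕ} (θ : ℝ) (A : Matrix (Fin n) (Fin n) ℝ) : Matrix (Fin n) (Fin n) ℝ :=
  fun i j => A i j - meanEntry θ A

/-- `M = max_{i,j} |a_{i,j} - a_{••}|`. -/
def maxDev {n : ℕ} (θ : ℝ) (A : Matrix (Fin n) (Fin n) ℝ) : ℝ :=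
  ⨆ p : Fin n × Fin n, |A p.1 p.2 - meanEntry θ A|

/-- The conditional mean, given `π = σ`, of Hoeffding's statistic at `τ_{I,J} π τ_{I,J}`, where
`(I, J)` is independent of `π` and uniform on the ordered pairs of distinct indices. -/
def conjMean {n : ℕ} (A : Matrix (Fin n) (Fin n) ℝ) (σ : Equiv.Perm (Fin n)) : ℝ :=
  (∑ i, ∑ j with j ≠ i, hoeffding A (Equiv.swap i j * σ * Equiv.swap i j)) / (n * (n - 1))

/-- The number `c₁(σ)` of fixed points. -/
def numFixed {n : ℕ} (σ : Equiv.Perm (Fin n)) : ℕ :=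
  (Finset.univ.filter fun i => σ i = i).card

/-- The quantity `T(σ)` behind the remainder, for an array `a` with mean entry zero. A cycle
containing `i` has length one exactly when `σ i = i`. -/
def remainderT {n : ℕ} (θ : ℝ) (a : Matrix (Fin n) (Fin n) ℝ) (σ : Equiv.Perm (Fin n)) : ℝ :=
  2 * (n + numFixed σ - 2 * (θ + 1)) * (∑ i with σ i = i, a i i)
    + 2 * (numFixed σ - 2 * θ) * (∑ i with σ i ≠ i, a i i)
    - 4 * (∑ i with σ i = i, ∑ j with σ j = j ∧ j ≠ i, a i j)
    - 4 * (∑ i with σ i = i, ∑ j with σ j ≠ j, a i j)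

/-- The remainder `R = E[T | Y] / (n (n - 1))`. -/
def remainder {Ω : Type*} [MeasurableSpace Ω] (μ : Measure Ω) {n : ℕ} (θ : ℝ)
    (A : Matrix (Fin n) (Fin n) ℝ) (π : Ω → Equiv.Perm (Fin n)) (Y : Ω → ℝ) : Ω → ℝ :=
  fun ω => (μ[fun ω' => remainderT θ (centredArray θ A) (π ω') |
    MeasurableSpace.comap Y inferInstance]) ω / (n * (n - 1))

/-- `κ_{θ,n,1}`; `descPochhammer` is the falling factorial. -/
def kappa1 (θ : ℝ) (n : ℕ) : ℝ :=
  Real.sqrt (θ ^ 2 * (descPochhammer ℝ 2).eval (n : ℝ) / (descPochhammer ℝ 2).eval (θ + n - 1)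
    + θ * n / (θ + n - 1))

/-- `κ_{θ,n,2}`. -/
def kappa2 (θ : ℝ) (n : ℕ) : ℝ :=
  Real.sqrt (θ ^ 4 * (descPochhammer ℝ 4).eval (n : ℝ) / (descPochhammer ℝ 4).eval (θ + n - 1)
    + 4 * θ ^ 3 * (descPochhammer ℝ 3).eval (n : ℝ) / (descPochhammer ℝ 3).eval (θ + n - 1)
    + 2 * θ ^ 2 * (descPochhammer ℝ 2).eval (n : ℝ) / (descPochhammer ℝ 2).eval (θ + n - 1))

/-! ### The constants of the concentration inequalities -/

/-- `|R|` and `e^{sY}` are negatively correlated for `0 < s < α`. -/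
def NegCorr {Ω : Type*} [MeasurableSpace Ω] (μ : Measure Ω) (Y R : Ω → ℝ) (α : ℝ) : Prop :=
  ∀ s, 0 < s → s < α → cov[fun ω => |R ω|, fun ω => Real.exp (s * Y ω); μ] ≤ 0

/-- The constant `B₁` attached to the range `0 < s < α`: it is `E|R| / lam` if `|R|` and `e^{sY}`
are negatively correlated on that range and `ess sup |E[R | Y]| / lam` otherwise. -/
def B1 {Ω : Type*} [MeasurableSpace Ω] (μ : Measure Ω) (Y R : Ω → ℝ) (lam α : ℝ) : ℝ :=
  open Classical in
  if NegCorr μ Y R α then (∫ ω, |R ω| ∂μ) / lam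
  else essSup (fun ω => |(μ[R | MeasurableSpace.comap Y inferInstance]) ω|) μ / lam

/-- The constant `B₂ = |E(YR)| / lam`. -/
def B2 {Ω : Type*} [MeasurableSpace Ω] (μ : Measure Ω) (Y R : Ω → ℝ) (lam : ℝ) : ℝ :=
  |∫ ω, Y ω * R ω ∂μ| / lam

/-- `(log x - log log x) / c` for `x > 1`, and zero otherwise. -/
def logAlpha (c x : ℝ) : ℝ :=
  if 1 < x then (Real.log x - Real.log (Real.log x)) / c else 0

/-- The constant `B₁` of the `t log t` bound. There `α` is `(log (t - B₁) - log log (t - B₁)) / c`,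
so `B₁ = E|R| / lam` if the negative correlation holds for the `α` computed with this value. -/
def B1log {Ω : Type*} [MeasurableSpace Ω] (μ : Measure Ω) (Y R : Ω → ℝ) (lam c t : ℝ) : ℝ :=
  B1 μ Y R lam (logAlpha c (t - (∫ ω, |R ω| ∂μ) / lam))

end

/-! The proof is Stein's method for exchangeable pairs applied to the moment generating function
`m(s) = E e^{sY}`. Conjugating `π` by a random transposition preserves cycle type, hence the Ewens
law, so `(Y, Y'')` is exchangeable. An exact count (`sum_hoeffding_conj_swap`) shows that its drift
is `-λY` plus the remainder. Exchangeability then gives, for every `f`, `E[(Y'' - Y)(f(Y'') - f(Y))]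
= 2 E[f(Y)(λY - R)]` when `R` is replaced by its unconditioned version `T / (n(n-1))`. With `f(y) =
e^{sy}` the right side contains `m'(s)`; with `f(y) = y` it contains the variance and `E(YR)`.

The left side for `e^{sy}` is at most `s (Y'' - Y)²` times an exponential, and these two factors
must be decoupled. The increment for `(i, j)` depends only on the four rows `i, j, π⁻¹(i), π⁻¹(j)`.
Deleting those points from their cycles leaves a permutation independent of the values there
(`sum_agreeing_isolateList`), because each deletion from a longer cycle creates one cycle and
multiplies the Ewens weight by `θ`. The statistic of the reduced permutation differs from both `S`
and `S''` by at most `8M`. Returning from it to `S` without conditioning costs at most `12M`. Hence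
the factor `e^{20Ms}` and `c = 20M`.

This yields `m'(s) ≤ (V s e^{cs} + B₁) m(s)` with `V = σ² + B₂`. Integrating it, applying Markov's
inequality and choosing `s` gives every tail bound. Replacing the array by its negative gives the
left tail. The bounds on `B₁` and `B₂` follow from a bound on `|T|` that is linear in the number of
fixed points (`abs_remainderT_le`), together with the first two moments of that number. -/

open Equiv in
/-- The permutation obtained from `σ` by deleting `a` from its cycle and making it a fixed point. -/
def isolate {α : Type*} [DecidableEq α] (a : α) (σ : Perm α) : Perm α :=
  swap a (σ a) * σ

/-! ### Cycle counts after the deletion of a point -/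

namespace Equiv.Perm

variable {α : Type*} [DecidableEq α]

lemma isolate_apply_self (a : α) (σ : Perm α) : isolate a σ a = a := by
  simp [isolate]

lemma isolate_apply_of_fixed {a k : α} {σ : Perm α} (h : σ k = k) : isolate a σ k = k := by
  by_cases hk : k = a
  · subst hk; exact isolate_apply_self k σ
  · rw [isolate, Perm.mul_apply, h, swap_apply_of_ne_of_ne hk]
    intro h'
    exact hk (σ.injective (h.trans h'))

lemma isolate_apply_of_ne {a k : α} {σ : Perm α} (hk : k ≠ a) (h : σ k ≠ a) :
    isolate a σ k = σ k := by
  rw [isolate, Perm.mul_apply, swap_apply_of_ne_of_ne h]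
  exact fun h' => hk (σ.injective h')

lemma isolate_eq_self {a : α} {σ : Perm α} (h : σ a = a) : isolate a σ = σ := by
  rw [isolate, h, swap_self]; rfl

variable [Fintype α]

lemma Disjoint.card_parts_add {f g : Perm α} (h : Disjoint f g) :
    Multiset.card (f * g).cycleType = Multiset.card f.cycleType + Multiset.card g.cycleType := by
  rw [h.cycleType_mul, Multiset.card_add]

/-- A two-cycle collapses to the identity; a longer cycle stays a cycle and loses one point. The
additive form avoids truncated subtraction. -/
lemma IsCycle.card_cycleType_isolate {c : Perm α} (hc : c.IsCycle) {a : α} (ha : c a ≠ a) :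
    Multiset.card (isolate a c).cycleType + c.support.card =
      1 + Multiset.card c.cycleType + (isolate a c).support.card := by
  rw [hc.cycleType, Multiset.card_singleton]
  by_cases h : c (c a) = a
  · have hs := hc.eq_swap_of_apply_apply_eq_self ha h
    have h1 : isolate a c = 1 := by
      rw [isolate]
      nth_rewrite 2 [hs]
      rw [swap_mul_self]
    rw [h1, hs, card_support_swap ha.symm]
    simp
  · have h1 : (isolate a c).IsCycle := hc.swap_mul ha h
    have h2 : (isolate a c).support = c.support \ {a} := support_swap_mul_eq c a h
    have h3 : a ∈ c.support := mem_support.2 ha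
    rw [h1.cycleType, h2, Finset.card_sdiff_of_subset (by simpa using h3)]
    have : 0 < c.support.card := Finset.card_pos.2 ⟨a, h3⟩
    simp
    omega

/-- Only the cycle through `a` changes, so the single-cycle case applies after splitting it off as a
disjoint factor. -/
lemma card_cycleType_isolate {σ : Perm α} {a : α} (ha : σ a ≠ a) :
    Multiset.card (isolate a σ).cycleType + σ.support.card =
      1 + Multiset.card σ.cycleType + (isolate a σ).support.card := by
  set c := σ.cycleOf a with hcdef
  have hc : c.IsCycle := isCycle_cycleOf σ ha
  have hca : c a = σ a := cycleOf_apply_self σ a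
  have hmem : c ∈ σ.cycleFactorsFinset :=
    cycleOf_mem_cycleFactorsFinset_iff.2 (mem_support.2 ha)
  have hd : Disjoint c (σ * c⁻¹) := (disjoint_mul_inv_of_mem_cycleFactorsFinset hmem).symm
  have hσ : σ = c * (σ * c⁻¹) := by
    rw [hd.commute.eq]; simp
  have hiso : isolate a σ = isolate a c * (σ * c⁻¹) := by
    rw [isolate, isolate, hca, mul_assoc, ← hσ]
  have hsub : (isolate a c).support ≤ c.support := by
    intro x hx
    exact (mem_support_swap_mul_imp_mem_support_ne hx).1
  have hd' : Disjoint (isolate a c) (σ * c⁻¹) := by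
    rw [disjoint_iff_disjoint_support] at hd ⊢
    exact hd.mono_left hsub
  have key := hc.card_cycleType_isolate (a := a) (by rwa [hca])
  have e1 := hd.card_parts_add
  have e2 := hd'.card_parts_add
  have e3 := hd.card_support_mul
  have e4 := hd'.card_support_mul
  rw [← hσ] at e1 e3
  rw [← hiso] at e2 e4
  omega

end Equiv.Perm

open Equiv.Perm

lemma numCycles_isolate {n : ℕ} {σ : Equiv.Perm (Fin n)} {a : Fin n} (ha : σ a ≠ a) :
    numCycles (isolate a σ) = numCycles σ + 1 := by
  have h := card_cycleType_isolate ha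
  have h1 := Finset.card_le_univ σ.support
  have h2 := Finset.card_le_univ (isolate a σ).support
  simp only [numCycles, parts_partition, Multiset.card_add, Multiset.card_replicate]
  omega

lemma numCycles_conj {n : ℕ} (σ τ : Equiv.Perm (Fin n)) :
    numCycles (τ * σ * τ⁻¹) = numCycles σ := by
  have h : IsConj σ (τ * σ * τ⁻¹) := isConj_iff.2 ⟨τ, rfl⟩
  rw [numCycles, numCycles, partition_eq_of_isConj.1 h]

/-! ### Weights on permutations -/

lemma ewensProb_pos {n : ℕ} {θ : ℝ} (hθ : 0 < θ) (σ : Equiv.Perm (Fin n)) :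
    0 < ewensProb θ σ :=
  div_pos (pow_pos hθ _) (ascPochhammer_pos n θ hθ)

lemma ewensProb_isolate {n : ℕ} (θ : ℝ) {σ : Equiv.Perm (Fin n)} {a : Fin n}
    (ha : σ a ≠ a) : ewensProb θ (isolate a σ) = θ * ewensProb θ σ := by
  rw [ewensProb, ewensProb, numCycles_isolate ha, pow_succ]; ring

lemma ewensProb_conj {n : ℕ} (θ : ℝ) (σ τ : Equiv.Perm (Fin n)) :
    ewensProb θ (τ * σ * τ⁻¹) = ewensProb θ σ := by
  rw [ewensProb, ewensProb, numCycles_conj]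

/-- Delete the points of a list, one after the other. -/
def isolateList {α : Type*} [DecidableEq α] : List α → Equiv.Perm α → Equiv.Perm α
  | [], σ => σ
  | a :: L, σ => isolateList L (isolate a σ)

lemma isolateList_apply_of_fixed {α : Type*} [DecidableEq α] (L : List α) {k : α} :
    ∀ {σ : Equiv.Perm α}, σ k = k → isolateList L σ k = k := by
  induction L with
  | nil => exact fun h => h
  | cons a L ih => exact fun h => ih (isolate_apply_of_fixed h)

lemma isolateList_apply_of_mem {α : Type*} [DecidableEq α] (L : List α) {k : α} (hk : k ∈ L) :
    ∀ σ : Equiv.Perm α, isolateList L σ k = k := by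
  induction L with
  | nil => simp at hk
  | cons a L ih =>
    intro σ
    rcases List.mem_cons.1 hk with rfl | h
    · exact isolateList_apply_of_fixed L (isolate_apply_self _ σ)
    · exact ih h _

lemma isolateList_apply_of_notMem {α : Type*} [DecidableEq α] (L : List α) {k : α}
    (hk : k ∉ L) : ∀ {σ : Equiv.Perm α}, σ k ∉ L → isolateList L σ k = σ k := by
  induction L with
  | nil => exact fun _ => rfl
  | cons a L ih =>
    intro σ h
    rw [List.mem_cons, not_or] at hk h
    have h1 : isolate a σ k = σ k := isolate_apply_of_ne hk.1 h.1
    rw [isolateList, ih hk.2 (by rw [h1]; exact h.2), h1]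

/-- The permutations that agree with `σ₀` on `K`. -/
def agreeing {n : ℕ} (K : List (Fin n)) (σ₀ : Equiv.Perm (Fin n)) :
    Finset (Equiv.Perm (Fin n)) :=
  Finset.univ.filter fun σ => ∀ k ∈ K, σ k = σ₀ k

lemma mem_agreeing {n : ℕ} {K : List (Fin n)} {σ₀ σ : Equiv.Perm (Fin n)} :
    σ ∈ agreeing K σ₀ ↔ ∀ k ∈ K, σ k = σ₀ k := by
  simp [agreeing]

lemma agreeing_congr {n : ℕ} {K : List (Fin n)} {σ₀ σ₁ : Equiv.Perm (Fin n)}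
    (h : ∀ k ∈ K, σ₀ k = σ₁ k) : agreeing K σ₀ = agreeing K σ₁ := by
  ext σ
  simp only [mem_agreeing]
  exact forall₂_congr fun k hk => by rw [h k hk]

/-- On the class, `σ a` is constant, so deleting `a` is left multiplication by one fixed
transposition. It is therefore a bijection between classes, and it scales the weight by a constant.
-/
lemma sum_agreeing_isolate {n : ℕ} {θ : ℝ} (hθ : 0 < θ) {K : List (Fin n)} {a : Fin n}
    (ha : a ∈ K) (σ₀ : Equiv.Perm (Fin n)) (g : Equiv.Perm (Fin n) → ℝ) :
    ∑ σ ∈ agreeing K σ₀, ewensProb θ σ * g (isolate a σ) =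
      (if σ₀ a = a then 1 else θ⁻¹) *
        ∑ σ ∈ agreeing K (isolate a σ₀), ewensProb θ σ * g σ := by
  rw [Finset.mul_sum]
  refine Finset.sum_bij' (fun σ _ => isolate a σ) (fun σ _ => Equiv.swap a (σ₀ a) * σ)
    ?_ ?_ ?_ ?_ ?_
  · intro σ hσ
    rw [mem_agreeing] at hσ ⊢
    intro k hk
    rw [isolate, isolate, mul_apply, mul_apply, hσ k hk, hσ a ha]
  · intro σ hσ
    rw [mem_agreeing] at hσ ⊢
    intro k hk
    rw [mul_apply, hσ k hk, isolate, mul_apply, Equiv.swap_apply_self]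
  · intro σ hσ
    rw [mem_agreeing] at hσ
    rw [isolate, hσ a ha, Equiv.swap_mul_self_mul]
  · intro σ hσ
    rw [mem_agreeing] at hσ
    have h : σ a = a := by rw [hσ a ha, isolate_apply_self]
    rw [isolate, mul_apply, h, Equiv.swap_apply_left, Equiv.swap_mul_self_mul]
  · intro σ hσ
    rw [mem_agreeing] at hσ
    split_ifs with h
    · rw [isolate_eq_self ((hσ a ha).trans h), one_mul]
    · rw [ewensProb_isolate θ (by rw [hσ a ha]; exact h)]
      field_simp

/-- The order of quantifiers is the point: `κ` depends on the class but not on `g`. -/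
lemma exists_sum_agreeing_isolateList {n : ℕ} {θ : ℝ} (hθ : 0 < θ) {K : List (Fin n)} :
    ∀ (L : List (Fin n)), (∀ a ∈ L, a ∈ K) → ∀ σ₀ : Equiv.Perm (Fin n),
      ∃ κ : ℝ, ∀ g : Equiv.Perm (Fin n) → ℝ,
        ∑ σ ∈ agreeing K σ₀, ewensProb θ σ * g (isolateList L σ) =
          κ * ∑ σ ∈ agreeing K (isolateList L σ₀), ewensProb θ σ * g σ
  | [], _, σ₀ => ⟨1, fun g => by simp [isolateList]⟩
  | a :: L, h, σ₀ => by
    obtain ⟨κ, hκ⟩ := exists_sum_agreeing_isolateList hθ L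
      (fun b hb => h b (List.mem_cons_of_mem a hb)) (isolate a σ₀)
    refine ⟨(if σ₀ a = a then 1 else θ⁻¹) * κ, fun g => ?_⟩
    have := sum_agreeing_isolate hθ (h a List.mem_cons_self) σ₀ (fun σ => g (isolateList L σ))
    simp only [isolateList] at this ⊢
    rw [this, hκ g, mul_assoc]

/-- Under the Ewens law, the permutation with the points of `K` deleted is independent of the
values on `K`. -/
theorem sum_agreeing_isolateList {n : ℕ} {θ : ℝ} (hθ : 0 < θ) (K : List (Fin n))
    (σ₀ : Equiv.Perm (Fin n)) (hone : ∑ σ : Equiv.Perm (Fin n), ewensProb θ σ = 1)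
    (g : Equiv.Perm (Fin n) → ℝ) :
    ∑ σ ∈ agreeing K σ₀, ewensProb θ σ * g (isolateList K σ) =
      (∑ σ ∈ agreeing K σ₀, ewensProb θ σ) * ∑ σ, ewensProb θ σ * g (isolateList K σ) := by
  -- After deletion every class lands on the permutations fixing `K` pointwise, with weights
  -- proportional to those in `A`. All conditional laws thus coincide, which is independence.
  set A : (Equiv.Perm (Fin n) → ℝ) → ℝ := fun g => ∑ σ ∈ agreeing K 1, ewensProb θ σ * g σ with hA
  have key : ∀ σ₁ : Equiv.Perm (Fin n), ∃ κ : ℝ, ∀ g : Equiv.Perm (Fin n) → ℝ,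
      ∑ σ ∈ agreeing K σ₁, ewensProb θ σ * g (isolateList K σ) = κ * A g := by
    intro σ₁
    obtain ⟨κ, hκ⟩ := exists_sum_agreeing_isolateList hθ K (fun _ h => h) σ₁
    refine ⟨κ, fun g => ?_⟩
    rw [hκ g, agreeing_congr (σ₁ := 1)]
    intro k hk
    exact isolateList_apply_of_mem K hk σ₁
  have hpos : 0 < A 1 := by
    refine Finset.sum_pos (fun σ _ => by simpa using ewensProb_pos hθ σ) ⟨1, ?_⟩
    simp [mem_agreeing]
  have prop : ∀ σ₁ : Equiv.Perm (Fin n), ∀ g : Equiv.Perm (Fin n) → ℝ,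
      (∑ σ ∈ agreeing K σ₁, ewensProb θ σ * g (isolateList K σ)) * A 1 =
        (∑ σ ∈ agreeing K σ₁, ewensProb θ σ) * A g := by
    intro σ₁ g
    obtain ⟨κ, hκ⟩ := key σ₁
    have h1 := hκ 1
    simp only [Pi.one_apply, mul_one] at h1
    rw [hκ g, h1]; ring
  -- Summing `prop` over all value patterns on `K` identifies the unconditional law with the common
  -- conditional one.
  have tot : (∑ σ, ewensProb θ σ * g (isolateList K σ)) * A 1 = A g := by
    have hfib : ∀ f : Equiv.Perm (Fin n) → ℝ, ∑ σ, f σ =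
        ∑ r : {x // x ∈ K} → Fin n,
          ∑ σ with (fun k : {x // x ∈ K} => σ (k : Fin n)) = r, f σ := fun f =>
      (Finset.sum_fiberwise Finset.univ _ f).symm
    have h1 := hone
    rw [hfib] at h1
    rw [hfib, Finset.sum_mul, ← one_mul (A g), ← h1, Finset.sum_mul]
    refine Finset.sum_congr rfl fun r _ => ?_
    by_cases hr : ∃ σ₁ : Equiv.Perm (Fin n), (fun k : {x // x ∈ K} => σ₁ (k : Fin n)) = r
    · obtain ⟨σ₁, hσ₁⟩ := hr
      have : (Finset.univ.filter fun σ : Equiv.Perm (Fin n) =>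
          (fun k : {x // x ∈ K} => σ (k : Fin n)) = r) = agreeing K σ₁ := by
        ext σ
        simp only [mem_agreeing, Finset.mem_filter, Finset.mem_univ, true_and, ← hσ₁, funext_iff,
          Subtype.forall]
      rw [this, prop]
    · rw [Finset.filter_false_of_mem fun σ _ h => hr ⟨σ, h⟩]
      simp
  have := prop σ₀ g
  rw [← tot, ← mul_assoc] at this
  exact mul_right_cancel₀ hpos.ne' this

/-! ### Point probabilities and moments of the number of fixed points -/

section Moments

variable {n : ℕ} {θ : ℝ}

lemma sum_agreeing_swap (hθ : 0 < θ) {K : List (Fin n)} (b c : Fin n) :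
    ∑ σ ∈ agreeing (b :: K) (Equiv.swap b c), ewensProb θ σ =
      (if c = b then 1 else θ⁻¹) * ∑ σ ∈ agreeing (b :: K) 1, ewensProb θ σ := by
  have h := sum_agreeing_isolate hθ (K := b :: K) (a := b) List.mem_cons_self
    (Equiv.swap b c) (fun _ => 1)
  simp only [mul_one, Equiv.swap_apply_left] at h
  rw [h, isolate, Equiv.swap_apply_left, Equiv.swap_mul_self]

/-- Split by the image of `b`. Points of `K` are already taken, `b` itself gives the smaller class,
and each of the `n - |K| - 1` others gives that class with weight `θ⁻¹`. This is the Chinese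
restaurant rule, and it produces all point probabilities below. -/
lemma sum_agreeing_one_eq (hθ : 0 < θ) {K : List (Fin n)} (hK : K.Nodup) {b : Fin n}
    (hb : b ∉ K) :
    ∑ σ ∈ agreeing K 1, ewensProb θ σ =
      (1 + (n - K.length - 1) / θ) * ∑ σ ∈ agreeing (b :: K) 1, ewensProb θ σ := by
  have h1 : ∀ c ∈ (Finset.univ : Finset (Fin n)),
      ∑ σ ∈ agreeing K 1 with σ b = c, ewensProb θ σ =
        (if c ∈ K then 0 else if c = b then 1 else θ⁻¹) *
          ∑ σ ∈ agreeing (b :: K) 1, ewensProb θ σ := by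
    intro c _
    split_ifs with hc hcb
    · rw [zero_mul]
      refine Finset.sum_eq_zero fun σ hσ => ?_
      simp only [Finset.mem_filter, mem_agreeing] at hσ
      have h2 := hσ.1 c hc
      rw [Equiv.Perm.one_apply] at h2
      exact absurd (σ.injective (hσ.2.trans h2.symm)) (fun h => hb (h ▸ hc))
    all_goals
      have h3 : (agreeing K 1).filter (fun σ => σ b = c) = agreeing (b :: K) (Equiv.swap b c) := by
        ext σ
        simp only [Finset.mem_filter, mem_agreeing, List.forall_mem_cons, Equiv.swap_apply_left]
        rw [and_comm]
        refine and_congr_right fun _ => forall₂_congr fun k hk => ?_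
        rw [Equiv.swap_apply_of_ne_of_ne (by rintro rfl; exact hb hk)
          (by rintro rfl; exact hc hk)]
        rfl
      rw [h3, sum_agreeing_swap hθ]
    · rw [if_pos hcb]
    · rw [if_neg hcb]
  rw [← Finset.sum_fiberwise (agreeing K 1) (fun σ => σ b), Finset.sum_congr rfl h1,
    ← Finset.sum_mul]
  congr 1
  have h4 : ∀ c : Fin n, (if c ∈ K then 0 else if c = b then 1 else θ⁻¹) =
      θ⁻¹ - (if c ∈ K.toFinset then θ⁻¹ else 0) + (if c = b then 1 - θ⁻¹ else 0) := by
    intro c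
    by_cases hc : c ∈ K
    · simp [hc, show c ≠ b from fun h => hb (h ▸ hc)]
    · by_cases hcb : c = b <;> simp [hc, hcb, hb]
  simp only [h4, Finset.sum_add_distrib, Finset.sum_sub_distrib, Finset.sum_const,
    Finset.sum_ite_mem, Finset.univ_inter, Finset.sum_ite_eq', Finset.mem_univ, if_true,
    Finset.card_univ, Fintype.card_fin, List.toFinset_card_of_nodup hK, nsmul_eq_mul]
  field_simp
  ring

lemma agreeing_nil (σ₀ : Equiv.Perm (Fin n)) : agreeing [] σ₀ = Finset.univ := by
  ext; simp [mem_agreeing]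

lemma one_lt_pos_of_two_le (hθ : 0 < θ) (hn : 2 ≤ n) :
    0 < θ + n - 1 ∧ 0 < θ + n - 2 := by
  have : (2 : ℝ) ≤ n := by exact_mod_cast hn
  constructor <;> linarith

lemma prob_fixed (hone : ∑ σ : Equiv.Perm (Fin n), ewensProb θ σ = 1)
    (hθ : 0 < θ) (hn : 2 ≤ n) (b : Fin n) :
    ∑ σ ∈ agreeing [b] 1, ewensProb θ σ = θ / (θ + n - 1) := by
  have h := sum_agreeing_one_eq hθ List.nodup_nil (b := b) List.not_mem_nil
  rw [agreeing_nil, hone] at h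
  have := (one_lt_pos_of_two_le hθ hn).1
  rw [eq_div_iff this.ne']
  simp only [List.length_nil, Nat.cast_zero, sub_zero] at h
  field_simp at h
  linarith

lemma prob_apply_eq (hone : ∑ σ : Equiv.Perm (Fin n), ewensProb θ σ = 1)
    (hθ : 0 < θ) (hn : 2 ≤ n) (b c : Fin n) :
    ∑ σ with σ b = c, ewensProb θ σ = (if c = b then θ else 1) / (θ + n - 1) := by
  have h := sum_agreeing_swap hθ (K := []) b c
  rw [prob_fixed hone hθ hn] at h
  have h2 : (Finset.univ.filter fun σ : Equiv.Perm (Fin n) => σ b = c) =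
      agreeing [b] (Equiv.swap b c) := by
    ext; simp [mem_agreeing]
  rw [h2, h]
  split_ifs <;> field_simp

lemma prob_fixed_fixed (hone : ∑ σ : Equiv.Perm (Fin n), ewensProb θ σ = 1) (hθ : 0 < θ)
    (hn : 2 ≤ n) {a b : Fin n} (hab : a ≠ b) :
    ∑ σ with σ a = a ∧ σ b = b, ewensProb θ σ = θ ^ 2 / ((θ + n - 1) * (θ + n - 2)) := by
  have h := sum_agreeing_one_eq hθ (List.nodup_singleton b) (b := a) (by simpa using hab)
  rw [prob_fixed hone hθ hn] at h
  have h2 : (Finset.univ.filter fun σ : Equiv.Perm (Fin n) => σ a = a ∧ σ b = b) =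
      agreeing [a, b] 1 := by
    ext; simp [mem_agreeing]
  obtain ⟨h3, h4⟩ := one_lt_pos_of_two_le hθ hn
  rw [h2, eq_div_iff (by positivity)]
  simp only [List.length_singleton, Nat.cast_one] at h
  field_simp at h
  linarith

lemma mean_hoeffding (hone : ∑ σ : Equiv.Perm (Fin n), ewensProb θ σ = 1)
    (hθ : 0 < θ) (hn : 2 ≤ n) (A : Matrix (Fin n) (Fin n) ℝ) :
    ∑ σ, ewensProb θ σ * hoeffding A σ = n * meanEntry θ A := by
  have h1 : ∀ i : Fin n, ∑ σ : Equiv.Perm (Fin n), ewensProb θ σ * A i (σ i) =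
      ∑ c, A i c * ((if c = i then θ else 1) / (θ + n - 1)) := by
    intro i
    rw [← Finset.sum_fiberwise Finset.univ (fun σ : Equiv.Perm (Fin n) => σ i)]
    refine Finset.sum_congr rfl fun c _ => ?_
    rw [← prob_apply_eq hone hθ hn, Finset.mul_sum]
    refine Finset.sum_congr rfl fun σ hσ => ?_
    rw [(Finset.mem_filter.1 hσ).2, mul_comm]
  have h2 : ∀ i : Fin n, ∑ c, A i c * ((if c = i then θ else 1) / (θ + n - 1)) =
      (θ * A i i + ∑ j with j ≠ i, A i j) / (θ + n - 1) := by
    intro i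
    rw [← Finset.add_sum_erase _ _ (Finset.mem_univ i), if_pos rfl, add_div, Finset.sum_div,
      ← Finset.filter_ne', mul_div_assoc', mul_comm θ]
    congr 1
    refine Finset.sum_congr rfl fun j hj => ?_
    rw [if_neg (Finset.mem_filter.1 hj).2, mul_one_div]
  have hn0 : (n : ℝ) ≠ 0 := by
    have : n ≠ 0 := by omega
    exact_mod_cast this
  simp only [hoeffding, Finset.mul_sum]
  rw [Finset.sum_comm]
  simp only [h1, h2]
  rw [meanEntry, ← Finset.sum_div, Finset.sum_add_distrib, ← Finset.mul_sum]
  have := (one_lt_pos_of_two_le hθ hn).1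
  field_simp

lemma numFixed_eq_sum (σ : Equiv.Perm (Fin n)) :
    (numFixed σ : ℝ) = ∑ i, if σ i = i then 1 else 0 := by
  rw [numFixed, Finset.card_filter]; push_cast; rfl

lemma mean_numFixed (hone : ∑ σ : Equiv.Perm (Fin n), ewensProb θ σ = 1)
    (hθ : 0 < θ) (hn : 2 ≤ n) :
    ∑ σ : Equiv.Perm (Fin n), ewensProb θ σ * numFixed σ = θ * n / (θ + n - 1) := by
  simp only [numFixed_eq_sum, Finset.mul_sum, mul_ite, mul_one, mul_zero]
  rw [Finset.sum_comm]
  simp only [← Finset.sum_filter, prob_apply_eq hone hθ hn, if_true, Finset.sum_const,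
    Finset.card_univ, Fintype.card_fin, nsmul_eq_mul]
  ring

lemma mean_numFixed_sq (hone : ∑ σ : Equiv.Perm (Fin n), ewensProb θ σ = 1)
    (hθ : 0 < θ) (hn : 2 ≤ n) :
    ∑ σ : Equiv.Perm (Fin n), ewensProb θ σ * (numFixed σ : ℝ) ^ 2 = kappa1 θ n ^ 2 := by
  obtain ⟨h3, h4⟩ := one_lt_pos_of_two_le hθ hn
  have hn2 : (2 : ℝ) ≤ n := by exact_mod_cast hn
  have hd : ∀ x : ℝ, (descPochhammer ℝ 2).eval x = x * (x - 1) := by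
    intro x; simp [descPochhammer_succ_right]
  have hk : kappa1 θ n ^ 2 = θ * n / (θ + n - 1) +
      n * (n - 1) * (θ ^ 2 / ((θ + n - 1) * (θ + n - 2))) := by
    rw [kappa1, Real.sq_sqrt]
    · rw [hd, hd, show θ + (n : ℝ) - 1 - 1 = θ + n - 2 by ring]
      field_simp
      ring
    · rw [hd, hd, show θ + (n : ℝ) - 1 - 1 = θ + n - 2 by ring]
      have : (0 : ℝ) ≤ n - 1 := by linarith
      positivity
  have h1 : ∀ i j : Fin n, ∑ σ : Equiv.Perm (Fin n),
      ewensProb θ σ * ((if σ i = i then 1 else 0) * (if σ j = j then 1 else 0)) =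
      if j = i then θ / (θ + n - 1) else θ ^ 2 / ((θ + n - 1) * (θ + n - 2)) := by
    intro i j
    split_ifs with h
    · subst h
      rw [show θ / (θ + n - 1) = (if j = j then θ else 1) / (θ + n - 1) by simp,
        ← prob_apply_eq hone hθ hn j j, Finset.sum_filter]
      refine Finset.sum_congr rfl fun σ _ => ?_
      split_ifs <;> simp
    · rw [← prob_fixed_fixed hone hθ hn (fun e => h e.symm), Finset.sum_filter]
      refine Finset.sum_congr rfl fun σ _ => ?_
      by_cases h5 : σ i = i <;> by_cases h6 : σ j = j <;> simp [h5, h6]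
  have h3 : ∀ σ : Equiv.Perm (Fin n), ewensProb θ σ * (numFixed σ : ℝ) ^ 2 =
      ∑ i, ∑ j, ewensProb θ σ * ((if σ i = i then 1 else 0) * (if σ j = j then 1 else 0)) := by
    intro σ
    rw [numFixed_eq_sum, sq, Finset.sum_mul_sum, Finset.mul_sum]
    simp only [Finset.mul_sum]
  simp only [h3]
  rw [Finset.sum_comm]
  have h2 : ∀ i : Fin n, ∑ σ : Equiv.Perm (Fin n), ∑ j : Fin n,
      ewensProb θ σ * ((if σ i = i then 1 else 0) * (if σ j = j then 1 else 0)) =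
      θ / (θ + n - 1) + (n - 1) * (θ ^ 2 / ((θ + n - 1) * (θ + n - 2))) := by
    intro i
    rw [Finset.sum_comm]
    simp only [h1]
    rw [Finset.sum_ite, Finset.filter_eq', Finset.filter_ne', if_pos (Finset.mem_univ i)]
    simp only [Finset.sum_const, Finset.card_singleton, Nat.cast_one, one_mul,
      Finset.card_erase_of_mem (Finset.mem_univ i),
      Finset.card_univ, Fintype.card_fin, nsmul_eq_mul]
    rw [Nat.cast_pred (by omega)]
  simp only [h2, Finset.sum_const, Finset.card_univ, Fintype.card_fin, nsmul_eq_mul]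
  rw [hk]
  ring

end Moments

/-! ### The approximate Stein pair -/

section SteinPair

variable {n : ℕ}

lemma hoeffding_conj_swap (a : Matrix (Fin n) (Fin n) ℝ) (σ : Equiv.Perm (Fin n)) (i j : Fin n) :
    hoeffding a (Equiv.swap i j * σ * Equiv.swap i j) =
      ∑ k, a (Equiv.swap i j k) (Equiv.swap i j (σ k)) := by
  rw [hoeffding, ← Equiv.sum_comp (Equiv.swap i j)]
  simp

lemma sum_swap_diag (a : Matrix (Fin n) (Fin n) ℝ) (k : Fin n) :
    ∑ i, ∑ j, a (Equiv.swap i j k) (Equiv.swap i j k) =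
      (n ^ 2 - 2 * n) * a k k + 2 * ∑ l, a l l := by
  have h : ∀ i j, a (Equiv.swap i j k) (Equiv.swap i j k) =
      a k k + (if i = k then a j j - a k k else 0) + (if j = k then a i i - a k k else 0) := by
    intro i j
    rw [Equiv.swap_apply_def]
    by_cases h1 : k = i
    · subst h1; by_cases h2 : j = k
      · subst h2; simp
      · simp [h2]
    · by_cases h2 : k = j
      · subst h2; simp [h1, Ne.symm h1]
      · simp [h1, h2, Ne.symm h1, Ne.symm h2]
  simp only [h, Finset.sum_add_distrib, Finset.sum_const, Finset.sum_ite_eq', Finset.sum_sub_distrib,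
    Finset.mem_univ, if_true, Finset.card_univ, Fintype.card_fin, nsmul_eq_mul]
  rw [Finset.sum_comm]
  simp only [Finset.sum_ite_eq', Finset.mem_univ, if_true, Finset.sum_sub_distrib,
    Finset.sum_const, Finset.card_univ, Fintype.card_fin, nsmul_eq_mul]
  ring

lemma sum_swap_offDiag {a : Matrix (Fin n) (Fin n) ℝ} (ha : ∀ i j, a i j = a j i) {k m : Fin n}
    (hkm : k ≠ m) :
    ∑ i, ∑ j, a (Equiv.swap i j k) (Equiv.swap i j m) =
      (n ^ 2 - 4 * n + 4) * a k m + 2 * (∑ l, a k l) + 2 * (∑ l, a m l)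
        - 2 * a k k - 2 * a m m := by
  -- Inclusion and exclusion over which of `i, j` meets `k` or `m`; the last two terms correct the
  -- case `{i, j} = {k, m}`.
  have h : ∀ i j, a (Equiv.swap i j k) (Equiv.swap i j m) =
      a k m + (if i = k then a j m - a k m else 0) + (if j = k then a i m - a k m else 0)
        + (if i = m then a k j - a k m else 0) + (if j = m then a k i - a k m else 0)
        + (if i = k then if j = m then a m k - a m m - a k k + a k m else 0 else 0)
        + (if i = m then if j = k then a m k - a m m - a k k + a k m else 0 else 0) := by
    intro i j
    simp only [Equiv.swap_apply_def, eq_comm (a := k), eq_comm (a := m)]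
    by_cases h1 : i = k <;> by_cases h2 : j = k <;> by_cases h3 : i = m <;> by_cases h4 : j = m <;>
      simp_all <;> ring
  have hc : ∑ l, a l m = ∑ l, a m l := Finset.sum_congr rfl fun l _ => ha l m
  have e1 : ∑ i, ∑ j, (if i = k then a j m - a k m else 0) = (∑ l, a m l) - n * a k m := by
    rw [Finset.sum_comm]; simp [Finset.sum_sub_distrib, hc]
  have e2 : ∑ i : Fin n, ∑ j, (if j = k then a i m - a k m else 0) = (∑ l, a m l) - n * a k m := by
    simp [Finset.sum_sub_distrib, hc]
  have e3 : ∑ i, ∑ j, (if i = m then a k j - a k m else 0) = (∑ l, a k l) - n * a k m := by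
    rw [Finset.sum_comm]; simp [Finset.sum_sub_distrib]
  have e4 : ∑ i : Fin n, ∑ j, (if j = m then a k i - a k m else 0) = (∑ l, a k l) - n * a k m := by
    simp [Finset.sum_sub_distrib]
  have e5 : ∀ x y : Fin n, ∀ r : ℝ, ∑ i, ∑ j, (if i = x then if j = y then r else 0 else 0) = r := by
    intro x y r
    rw [Finset.sum_comm]; simp
  simp only [h, Finset.sum_add_distrib, e1, e2, e3, e4, e5]
  simp only [Finset.sum_const, Finset.card_univ, Fintype.card_fin, nsmul_eq_mul, ha m k]
  ring

/-- Conjugation by a random transposition contracts the centred statistic up to the remainder. -/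
theorem sum_hoeffding_conj_swap {θ : ℝ} {a : Matrix (Fin n) (Fin n) ℝ}
    (ha : ∀ i j, a i j = a j i)
    (h0 : θ * ∑ i, a i i + ∑ i, ∑ j with j ≠ i, a i j = 0) (σ : Equiv.Perm (Fin n)) :
    ∑ i, ∑ j with j ≠ i, hoeffding a (Equiv.swap i j * σ * Equiv.swap i j) =
      (n * (n - 1) - 4 * (n - 1)) * hoeffding a σ + remainderT θ a σ := by
  have hoff : ∀ (f : Fin n → ℝ) (i : Fin n), ∑ j with j ≠ i, f j = (∑ j, f j) - f i := by
    intro f i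
    rw [Finset.filter_ne', ← Finset.add_sum_erase _ f (Finset.mem_univ i)]; ring
  -- The vanishing weighted mean expresses the total of the array through its trace; this is how `θ`
  -- enters `remainderT`.
  have hrow : ∑ i, ∑ j, a i j = (1 - θ) * ∑ i, a i i := by
    simp only [hoff, Finset.sum_sub_distrib] at h0
    linarith
  have hdiag : ∀ i : Fin n, hoeffding a (Equiv.swap i i * σ * Equiv.swap i i) = hoeffding a σ := by
    intro i
    rw [Equiv.swap_self]; rfl
  set d := ∑ i with σ i = i, a i i with hd
  set e := ∑ i with ¬ σ i = i, a i i with he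
  have hde : ∑ i, a i i = d + e := (Finset.sum_filter_add_sum_filter_not _ _ _).symm
  -- `σ` permutes its non-fixed points, so sums over `k` and over `σ k` agree there.
  have hfree : ∑ k with ¬ σ k = k, a (σ k) (σ k) = e := by
    have h1 := Equiv.sum_comp σ (fun k => a k k)
    rw [← Finset.sum_filter_add_sum_filter_not _ (fun k => σ k = k), hde] at h1
    have h2 : ∑ k with σ k = k, a (σ k) (σ k) = d :=
      Finset.sum_congr rfl fun k hk => by rw [(Finset.mem_filter.1 hk).2]
    linarith
  set r : Fin n → ℝ := fun k => ∑ l, a k l with hr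
  have hrfree : ∑ k with ¬ σ k = k, r (σ k) = ∑ k with ¬ σ k = k, r k := by
    have h1 := Equiv.sum_comp σ r
    rw [← Finset.sum_filter_add_sum_filter_not _ (fun k => σ k = k),
      ← Finset.sum_filter_add_sum_filter_not Finset.univ (fun k => σ k = k) r] at h1
    have h2 : ∑ k with σ k = k, r (σ k) = ∑ k with σ k = k, r k :=
      Finset.sum_congr rfl fun k hk => by rw [(Finset.mem_filter.1 hk).2]
    linarith
  have hrsum : ∑ k with ¬ σ k = k, r k = (1 - θ) * (d + e) - ∑ k with σ k = k, r k := by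
    rw [← hde, ← hrow, ← Finset.sum_filter_add_sum_filter_not Finset.univ (fun k => σ k = k) r]
    ring
  have hrfix : ∑ k with σ k = k, r k = d + (∑ i with σ i = i, ∑ j with σ j = j ∧ j ≠ i, a i j)
      + ∑ i with σ i = i, ∑ j with σ j ≠ j, a i j := by
    rw [hd, ← Finset.sum_add_distrib, ← Finset.sum_add_distrib]
    refine Finset.sum_congr rfl fun i hi => ?_
    have h3 : (Finset.univ.filter fun j => σ j = j ∧ j ≠ i) =
        (Finset.univ.filter fun j => σ j = j).erase i := by
      ext j; simp [and_comm]
    rw [hr, h3, Finset.add_sum_erase _ (fun j => a i j) hi,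
      Finset.sum_filter_add_sum_filter_not]
  have hS : hoeffding a σ = d + ∑ k with ¬ σ k = k, a k (σ k) := by
    rw [hoeffding, ← Finset.sum_filter_add_sum_filter_not _ (fun k => σ k = k)]
    congr 1
    exact Finset.sum_congr rfl fun k hk => by rw [(Finset.mem_filter.1 hk).2]
  -- All pairs are summed, including `i = j`; those trivial conjugations contribute `n` copies of
  -- the statistic, removed at the end.
  have hfull : ∑ i, ∑ j, hoeffding a (Equiv.swap i j * σ * Equiv.swap i j) =
      ((n ^ 2 - 2 * n) * d + 2 * numFixed σ * (d + e)) +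
      ((n ^ 2 - 4 * n + 4) * (hoeffding a σ - d) + 4 * (∑ k with ¬ σ k = k, r k) - 4 * e) := by
    have h4 : ∑ i, ∑ j, hoeffding a (Equiv.swap i j * σ * Equiv.swap i j) =
        ∑ k, ∑ i, ∑ j, a (Equiv.swap i j k) (Equiv.swap i j (σ k)) := by
      simp only [hoeffding_conj_swap]
      exact (Finset.sum_congr rfl fun i _ => Finset.sum_comm).trans Finset.sum_comm
    rw [h4, ← Finset.sum_filter_add_sum_filter_not _ (fun k => σ k = k)]
    congr 1
    · rw [Finset.sum_congr rfl fun k hk => by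
        rw [(Finset.mem_filter.1 hk).2, sum_swap_diag a k]]
      rw [Finset.sum_add_distrib, ← Finset.mul_sum, Finset.sum_const, hde, nsmul_eq_mul]
      change _ + (numFixed σ : ℝ) * _ = _
      ring
    · rw [Finset.sum_congr rfl fun k hk =>
        sum_swap_offDiag ha (Ne.symm (Finset.mem_filter.1 hk).2)]
      simp only [Finset.sum_add_distrib, Finset.sum_sub_distrib, ← Finset.mul_sum]
      rw [hfree, ← he]
      change _ + 2 * (∑ k with ¬ σ k = k, r k) + 2 * (∑ k with ¬ σ k = k, r (σ k)) - _ - _ = _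
      rw [hrfree, hS]
      ring
  simp only [hoff, Finset.sum_sub_distrib, hdiag, Finset.sum_const, Finset.card_univ,
    Fintype.card_fin, nsmul_eq_mul]
  rw [hfull, hrsum, hrfix, remainderT, ← hd]
  change _ = _ + (_ + 2 * (numFixed σ - 2 * θ) * e - _ - _)
  ring

end SteinPair

/-! ### Decorrelating the exponential from the squared increments -/

section Decorrelation

variable {n : ℕ}

/-- A row of `K` occurs in one sum only and costs `M`; a row of `B` may have two different entries
and costs `2M`. -/
lemma abs_hoeffding_sub_sum_le {a : Matrix (Fin n) (Fin n) ℝ} {M : ℝ} (hM : ∀ i j, |a i j| ≤ M)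
    (hM0 : 0 ≤ M) (K B : Finset (Fin n)) (ρ τ : Equiv.Perm (Fin n))
    (h : ∀ k, k ∉ K → k ∉ B → ρ k = τ k) :
    |hoeffding a ρ - ∑ k ∈ Kᶜ, a k (τ k)| ≤ (K.card + 2 * B.card) * M := by
  have h1 : hoeffding a ρ - ∑ k ∈ Kᶜ, a k (τ k) =
      ∑ k ∈ K, a k (ρ k) + ∑ k ∈ Kᶜ, (a k (ρ k) - a k (τ k)) := by
    rw [hoeffding, ← Finset.sum_add_sum_compl K, Finset.sum_sub_distrib]; ring
  have h2 : |∑ k ∈ K, a k (ρ k)| ≤ K.card * M := by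
    refine (Finset.abs_sum_le_sum_abs _ _).trans ?_
    refine (Finset.sum_le_card_nsmul _ _ M fun k _ => hM k _).trans_eq ?_
    rw [nsmul_eq_mul]
  have h3 : |∑ k ∈ Kᶜ, (a k (ρ k) - a k (τ k))| ≤ B.card * (2 * M) := by
    refine (Finset.abs_sum_le_sum_abs _ _).trans ?_
    calc ∑ k ∈ Kᶜ, |a k (ρ k) - a k (τ k)|
        ≤ ∑ k ∈ Kᶜ, (if k ∈ B then 2 * M else 0) := by
          refine Finset.sum_le_sum fun k hk => ?_
          split_ifs with hB
          · refine (abs_sub _ _).trans ?_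
            linarith [hM k (ρ k), hM k (τ k)]
          · rw [h k (Finset.mem_compl.1 hk) hB]; simp
      _ ≤ ∑ k, (if k ∈ B then 2 * M else 0) :=
          Finset.sum_le_sum_of_subset_of_nonneg (Finset.subset_univ _) fun k _ _ => by
            split_ifs <;> linarith
      _ = B.card * (2 * M) := by
          rw [Finset.sum_ite_mem, Finset.univ_inter, Finset.sum_const, nsmul_eq_mul]
  rw [h1]
  refine (abs_add_le _ _).trans ?_
  linarith

/-- The rows in which `σ` and `τ_{i,j} σ τ_{i,j}` may differ. -/
def swapRows (i j : Fin n) (σ : Equiv.Perm (Fin n)) : List (Fin n) :=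
  [i, j, σ.symm i, σ.symm j]

lemma conj_swap_apply_of_notMem {i j k : Fin n} {σ : Equiv.Perm (Fin n)}
    (hk : k ∉ swapRows i j σ) : (Equiv.swap i j * σ * Equiv.swap i j) k = σ k := by
  simp only [swapRows, List.mem_cons, List.not_mem_nil, or_false, not_or, Equiv.eq_symm_apply] at hk
  obtain ⟨h1, h2, h3, h4⟩ := hk
  rw [mul_apply, mul_apply, Equiv.swap_apply_of_ne_of_ne h1 h2, Equiv.swap_apply_of_ne_of_ne h3 h4]

lemma conj_swap_apply_congr {i j k : Fin n} {σ σ₀ : Equiv.Perm (Fin n)}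
    (h : ∀ k ∈ swapRows i j σ₀, σ k = σ₀ k) (hk : k ∈ swapRows i j σ₀) :
    (Equiv.swap i j * σ * Equiv.swap i j) k = (Equiv.swap i j * σ₀ * Equiv.swap i j) k := by
  rw [mul_apply, mul_apply, mul_apply, mul_apply, h]
  rw [Equiv.swap_apply_def]
  split_ifs
  · simp [swapRows]
  · simp [swapRows]
  · exact hk

lemma increment_congr {a : Matrix (Fin n) (Fin n) ℝ} {i j : Fin n} {σ σ₀ : Equiv.Perm (Fin n)}
    (hrow : swapRows i j σ = swapRows i j σ₀) (h : ∀ k ∈ swapRows i j σ₀, σ k = σ₀ k) :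
    hoeffding a (Equiv.swap i j * σ * Equiv.swap i j) - hoeffding a σ =
      hoeffding a (Equiv.swap i j * σ₀ * Equiv.swap i j) - hoeffding a σ₀ := by
  simp only [hoeffding, ← Finset.sum_sub_distrib]
  refine Finset.sum_congr rfl fun k _ => ?_
  by_cases hk : k ∈ swapRows i j σ₀
  · rw [conj_swap_apply_congr h hk, h k hk]
  · rw [conj_swap_apply_of_notMem hk, conj_swap_apply_of_notMem (hrow ▸ hk), sub_self, sub_self]

/-- The part of the statistic outside the rows `K`. -/
def outerSum (a : Matrix (Fin n) (Fin n) ℝ) (K : List (Fin n)) (τ : Equiv.Perm (Fin n)) : ℝ :=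
  ∑ k ∈ K.toFinsetᶜ, a k (τ k)

variable {a : Matrix (Fin n) (Fin n) ℝ} {M : ℝ}

/-- Outside `K`, deletion can alter only rows sent into `K`, and there are at most `|K|` of them:
`|K| + 2|K|`. -/
lemma abs_hoeffding_sub_outerSum_le (hM : ∀ i j, |a i j| ≤ M) (hM0 : 0 ≤ M) (K : List (Fin n))
    (σ : Equiv.Perm (Fin n)) :
    |hoeffding a σ - outerSum a K (isolateList K σ)| ≤ 3 * K.length * M := by
  have h1 := abs_hoeffding_sub_sum_le hM hM0 K.toFinset (K.toFinset.image σ.symm) σ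
    (isolateList K σ) fun k hk hB => by
      rw [isolateList_apply_of_notMem K (by simpa using hk)]
      intro hmem
      exact hB (Finset.mem_image.2 ⟨σ k, by simpa using hmem, by simp⟩)
  have h2 : (K.toFinset.card : ℝ) ≤ K.length := by exact_mod_cast K.toFinset_card_le
  have h3 : ((K.toFinset.image σ.symm).card : ℝ) ≤ K.toFinset.card := by
    exact_mod_cast Finset.card_image_le
  refine h1.trans (mul_le_mul_of_nonneg_right ?_ hM0)
  linarith

/-- Here `K` already contains the preimages of `i` and `j`, so at most two further rows, their
second preimages, can be altered: `4 + 2 · 2 = 8`. Any change of `σ` inside `K` is free, so the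
bound covers `S` and `S''` alike. -/
lemma abs_hoeffding_sub_outerSum_swapRows_le (hM : ∀ i j, |a i j| ≤ M) (hM0 : 0 ≤ M)
    {i j : Fin n} {σ ρ : Equiv.Perm (Fin n)} (hρ : ∀ k ∉ swapRows i j σ, ρ k = σ k) :
    |hoeffding a ρ - outerSum a (swapRows i j σ) (isolateList (swapRows i j σ) σ)| ≤ 8 * M := by
  set K := swapRows i j σ with hK
  have h1 := abs_hoeffding_sub_sum_le hM hM0 K.toFinset
    {σ.symm (σ.symm i), σ.symm (σ.symm j)} ρ (isolateList K σ) fun k hk hB => by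
      rw [List.mem_toFinset] at hk
      rw [isolateList_apply_of_notMem K hk, hρ k hk]
      simp only [hK, swapRows, List.mem_cons, List.not_mem_nil, or_false, Finset.mem_insert,
        Finset.mem_singleton, not_or, Equiv.eq_symm_apply] at hk hB ⊢
      exact ⟨hk.2.2.1, hk.2.2.2, hB.1, hB.2⟩
  have h2 : (K.toFinset.card : ℝ) ≤ 4 := by exact_mod_cast K.toFinset_card_le
  have h3 : (({σ.symm (σ.symm i), σ.symm (σ.symm j)} : Finset (Fin n)).card : ℝ) ≤ 2 := by
    exact_mod_cast Finset.card_le_two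
  refine h1.trans (mul_le_mul_of_nonneg_right ?_ hM0)
  linarith

lemma sub_mul_exp_sub_exp_le {s x y z : ℝ} (hs : 0 ≤ s) (hx : x ≤ z) (hy : y ≤ z) :
    (x - y) * (Real.exp (s * x) - Real.exp (s * y)) ≤ s * (x - y) ^ 2 * Real.exp (s * z) := by
  wlog hxy : y ≤ x generalizing x y
  · have := this hy hx (le_of_not_ge hxy)
    linarith
  have h1 : Real.exp (s * y) = Real.exp (s * x) * Real.exp (s * (y - x)) := by
    rw [← Real.exp_add]; ring_nf
  have h2 := Real.add_one_le_exp (s * (y - x))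
  have h3 : Real.exp (s * x) ≤ Real.exp (s * z) :=
    Real.exp_le_exp.2 (mul_le_mul_of_nonneg_left hx hs)
  have h4 : 0 ≤ x - y := sub_nonneg.2 hxy
  calc (x - y) * (Real.exp (s * x) - Real.exp (s * y))
      = (x - y) * (Real.exp (s * x) * (1 - Real.exp (s * (y - x)))) := by rw [h1]; ring
    _ ≤ (x - y) * (Real.exp (s * x) * (s * (x - y))) := by
        gcongr
        linarith
    _ ≤ (x - y) * (Real.exp (s * z) * (s * (x - y))) := by gcongr
    _ = _ := by ring

/-- The decoupling: a conditional expectation given the local pattern of `σ` is bounded through the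
independent reduced permutation. -/
theorem sum_increment_exp_le {θ s : ℝ} (hθ : 0 < θ)
    (hone : ∑ σ : Equiv.Perm (Fin n), ewensProb θ σ = 1)
    (hM : ∀ i j, |a i j| ≤ M) (hM0 : 0 ≤ M) (hs : 0 ≤ s) (i j : Fin n) :
    ∑ σ, ewensProb θ σ *
        ((hoeffding a (Equiv.swap i j * σ * Equiv.swap i j) - hoeffding a σ) *
          (Real.exp (s * hoeffding a (Equiv.swap i j * σ * Equiv.swap i j)) -
            Real.exp (s * hoeffding a σ))) ≤
      s * Real.exp (20 * M * s) * (∑ σ, ewensProb θ σ * Real.exp (s * hoeffding a σ)) *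
        ∑ σ, ewensProb θ σ *
          (hoeffding a (Equiv.swap i j * σ * Equiv.swap i j) - hoeffding a σ) ^ 2 := by
  set m := ∑ σ, ewensProb θ σ * Real.exp (s * hoeffding a σ) with hm
  -- The preimages are recorded so that the random list `swapRows i j σ`, and with it the increment,
  -- is constant on each class.
  set pat : Equiv.Perm (Fin n) → Fin n × Fin n × Fin n × Fin n := fun σ =>
    (σ i, σ j, σ.symm i, σ.symm j) with hpat
  rw [Finset.mul_sum, ← Finset.sum_fiberwise Finset.univ pat,
    ← Finset.sum_fiberwise Finset.univ pat (fun σ => s * Real.exp (20 * M * s) * m * _)]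
  refine Finset.sum_le_sum fun r _ => ?_
  by_cases hr : ∃ σ₀, pat σ₀ = r
  swap
  · rw [Finset.filter_false_of_mem fun σ _ h => hr ⟨σ, h⟩]
    simp
  obtain ⟨σ₀, rfl⟩ := hr
  set K := swapRows i j σ₀ with hK
  have hclass : (Finset.univ.filter fun σ => pat σ = pat σ₀) = agreeing K σ₀ := by
    ext σ
    simp only [Finset.mem_filter, Finset.mem_univ, true_and, mem_agreeing, hK, swapRows, hpat,
      Prod.mk.injEq, List.forall_mem_cons, List.not_mem_nil, IsEmpty.forall_iff, implies_true,
      and_true, Equiv.apply_symm_apply]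
    refine and_congr_right fun _ => and_congr_right fun _ => and_congr ?_ ?_
    · rw [Equiv.symm_apply_eq, eq_comm]
    · rw [Equiv.symm_apply_eq, eq_comm]
  have hrows : ∀ σ ∈ agreeing K σ₀, swapRows i j σ = K := by
    intro σ hσ
    rw [← hclass] at hσ
    simp only [Finset.mem_filter, hpat, Prod.mk.injEq] at hσ
    rw [hK, swapRows, swapRows, hσ.2.2.2.1, hσ.2.2.2.2]
  have hinc : ∀ σ ∈ agreeing K σ₀,
      hoeffding a (Equiv.swap i j * σ * Equiv.swap i j) - hoeffding a σ =
        hoeffding a (Equiv.swap i j * σ₀ * Equiv.swap i j) - hoeffding a σ₀ := fun σ hσ =>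
    increment_congr (hrows σ hσ) (mem_agreeing.1 hσ)
  set d := hoeffding a (Equiv.swap i j * σ₀ * Equiv.swap i j) - hoeffding a σ₀ with hd
  rw [hclass]
  have hp : ∀ σ : Equiv.Perm (Fin n), 0 ≤ ewensProb θ σ := fun σ => (ewensProb_pos hθ σ).le
  -- Here `σ` is arbitrary and `K` need not be its own `swapRows`, so only the general bound `3 · 4
  -- · M` is available.
  have hup : ∀ σ, Real.exp (s * outerSum a K (isolateList K σ)) ≤
      Real.exp (12 * M * s) * Real.exp (s * hoeffding a σ) := by
    intro σ
    rw [← Real.exp_add, Real.exp_le_exp]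
    have h1 := neg_le_of_abs_le (abs_hoeffding_sub_outerSum_le hM hM0 K σ)
    have h2 : ((K.length : ℕ) : ℝ) = 4 := by simp [hK, swapRows]
    rw [h2] at h1
    nlinarith
  calc ∑ σ ∈ agreeing K σ₀, ewensProb θ σ *
        ((hoeffding a (Equiv.swap i j * σ * Equiv.swap i j) - hoeffding a σ) *
          (Real.exp (s * hoeffding a (Equiv.swap i j * σ * Equiv.swap i j)) -
            Real.exp (s * hoeffding a σ)))
      ≤ ∑ σ ∈ agreeing K σ₀, s * d ^ 2 * Real.exp (8 * M * s) * (ewensProb θ σ *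
          Real.exp (s * outerSum a K (isolateList K σ))) := by
        refine Finset.sum_le_sum fun σ hσ => ?_
        have h1 := abs_hoeffding_sub_outerSum_swapRows_le hM hM0 (i := i) (j := j) (σ := σ)
          (ρ := σ) (fun _ _ => rfl)
        have h2 := abs_hoeffding_sub_outerSum_swapRows_le hM hM0 (i := i) (j := j) (σ := σ)
          (ρ := Equiv.swap i j * σ * Equiv.swap i j) (fun _ hk => conj_swap_apply_of_notMem hk)
        rw [hrows σ hσ] at h1 h2
        have h3 := sub_mul_exp_sub_exp_le hs
          (x := hoeffding a (Equiv.swap i j * σ * Equiv.swap i j)) (y := hoeffding a σ)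
          (z := outerSum a K (isolateList K σ) + 8 * M)
          (by linarith [le_of_abs_le h2]) (by linarith [le_of_abs_le h1])
        rw [hinc σ hσ] at h3 ⊢
        refine (mul_le_mul_of_nonneg_left h3 (hp σ)).trans_eq ?_
        rw [mul_add, Real.exp_add]
        ring_nf
    _ = s * d ^ 2 * Real.exp (8 * M * s) * ((∑ σ ∈ agreeing K σ₀, ewensProb θ σ) *
          ∑ σ, ewensProb θ σ * Real.exp (s * outerSum a K (isolateList K σ))) := by
        rw [← Finset.mul_sum, sum_agreeing_isolateList hθ K σ₀ hone
          (fun τ => Real.exp (s * outerSum a K τ))]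
    _ ≤ s * d ^ 2 * Real.exp (8 * M * s) * ((∑ σ ∈ agreeing K σ₀, ewensProb θ σ) *
          (Real.exp (12 * M * s) * m)) := by
        have h5 : ∑ σ, ewensProb θ σ * Real.exp (s * outerSum a K (isolateList K σ)) ≤
            Real.exp (12 * M * s) * m := by
          rw [hm, Finset.mul_sum]
          refine Finset.sum_le_sum fun σ _ => ?_
          refine (mul_le_mul_of_nonneg_left (hup σ) (hp σ)).trans_eq ?_
          ring
        have h6 : 0 ≤ ∑ σ ∈ agreeing K σ₀, ewensProb θ σ := Finset.sum_nonneg fun σ _ => hp σ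
        gcongr
    _ = ∑ σ ∈ agreeing K σ₀, s * Real.exp (20 * M * s) * m * (ewensProb θ σ *
          (hoeffding a (Equiv.swap i j * σ * Equiv.swap i j) - hoeffding a σ) ^ 2) := by
        have h7 : ∑ σ ∈ agreeing K σ₀, ewensProb θ σ *
            (hoeffding a (Equiv.swap i j * σ * Equiv.swap i j) - hoeffding a σ) ^ 2 =
            (∑ σ ∈ agreeing K σ₀, ewensProb θ σ) * d ^ 2 := by
          rw [Finset.sum_mul]
          exact Finset.sum_congr rfl fun σ hσ => by rw [hinc σ hσ]
        rw [← Finset.mul_sum, h7,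
          show 20 * M * s = 8 * M * s + 12 * M * s by ring, Real.exp_add]
        ring

/-- Exchangeability of `σ` and `τ_{i,j} σ τ_{i,j}`. -/
lemma sum_increment_mul (θ : ℝ) (a : Matrix (Fin n) (Fin n) ℝ) (i j : Fin n) (f : ℝ → ℝ) :
    ∑ σ, ewensProb θ σ *
        ((hoeffding a (Equiv.swap i j * σ * Equiv.swap i j) - hoeffding a σ) *
          (f (hoeffding a (Equiv.swap i j * σ * Equiv.swap i j)) - f (hoeffding a σ))) =
      2 * ∑ σ, ewensProb θ σ * (f (hoeffding a σ) *
        (hoeffding a σ - hoeffding a (Equiv.swap i j * σ * Equiv.swap i j))) := by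
  set t := Equiv.swap i j with ht
  have hinv : ∀ σ : Equiv.Perm (Fin n), t * (t * σ * t) * t = σ := by
    intro σ
    rw [ht]
    simp [mul_assoc]
  have hp : ∀ σ : Equiv.Perm (Fin n), ewensProb θ (t * σ * t) = ewensProb θ σ := by
    intro σ
    conv_lhs => rw [show t * σ * t = t * σ * t⁻¹ by rw [ht, Equiv.swap_inv]]
    exact ewensProb_conj θ σ t
  have h1 : ∑ σ, ewensProb θ σ * (f (hoeffding a (t * σ * t)) *
      (hoeffding a (t * σ * t) - hoeffding a σ)) =
      ∑ σ, ewensProb θ σ * (f (hoeffding a σ) * (hoeffding a σ - hoeffding a (t * σ * t))) := by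
    refine Finset.sum_bij' (fun σ _ => t * σ * t) (fun σ _ => t * σ * t) (by simp) (by simp)
      (fun σ _ => hinv σ) (fun σ _ => hinv σ) fun σ _ => ?_
    rw [hp, hinv]
  rw [two_mul]
  nth_rewrite 1 [← h1]
  rw [← Finset.sum_add_distrib]
  refine Finset.sum_congr rfl fun σ _ => ?_
  ring

lemma sum_sum_increment_mul {θ : ℝ} (ha : ∀ i j, a i j = a j i)
    (h0 : θ * ∑ i, a i i + ∑ i, ∑ j with j ≠ i, a i j = 0) (f : ℝ → ℝ) :
    ∑ i, ∑ j with j ≠ i, ∑ σ, ewensProb θ σ *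
        ((hoeffding a (Equiv.swap i j * σ * Equiv.swap i j) - hoeffding a σ) *
          (f (hoeffding a (Equiv.swap i j * σ * Equiv.swap i j)) - f (hoeffding a σ))) =
      2 * ∑ σ, ewensProb θ σ * (f (hoeffding a σ) *
        (4 * (n - 1) * hoeffding a σ - remainderT θ a σ)) := by
  simp only [sum_increment_mul, ← Finset.mul_sum]
  congr 1
  rw [Finset.sum_congr rfl fun i _ => Finset.sum_comm, Finset.sum_comm]
  refine Finset.sum_congr rfl fun σ _ => ?_
  simp only [← Finset.mul_sum, Finset.sum_sub_distrib]
  rw [sum_hoeffding_conj_swap ha h0 σ]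
  have hcard : ∑ i : Fin n, ∑ j : Fin n with j ≠ i, hoeffding a σ =
      n * (n - 1) * hoeffding a σ := by
    rcases Nat.eq_zero_or_pos n with rfl | hn
    · simp
    simp only [Finset.filter_ne', Finset.sum_const, Finset.card_erase_of_mem (Finset.mem_univ _),
      Finset.card_univ, Fintype.card_fin, nsmul_eq_mul]
    rw [Nat.cast_pred hn]; ring
  rw [hcard]
  ring

/-- The moment generating function of a centred Hoeffding statistic under the Ewens law satisfies
a differential inequality. -/
theorem sum_hoeffding_mul_exp_le {θ s : ℝ} (hθ : 0 < θ)
    (hone : ∑ σ : Equiv.Perm (Fin n), ewensProb θ σ = 1) (ha : ∀ i j, a i j = a j i)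
    (h0 : θ * ∑ i, a i i + ∑ i, ∑ j with j ≠ i, a i j = 0)
    (hM : ∀ i j, |a i j| ≤ M) (hM0 : 0 ≤ M) (hs : 0 ≤ s) :
    ∑ σ, ewensProb θ σ * (Real.exp (s * hoeffding a σ) *
        (4 * (n - 1) * hoeffding a σ - remainderT θ a σ)) ≤
      s * Real.exp (20 * M * s) * (∑ σ, ewensProb θ σ * Real.exp (s * hoeffding a σ)) *
        ∑ σ, ewensProb θ σ * (hoeffding a σ *
          (4 * (n - 1) * hoeffding a σ - remainderT θ a σ)) := by
  -- One identity is used twice: the exponential gives the left side, and the identity function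
  -- evaluates the mean squared increment on the right.
  have h1 := sum_sum_increment_mul ha h0 (fun x => Real.exp (s * x)) (θ := θ)
  have h2 := sum_sum_increment_mul ha h0 (fun x => x) (θ := θ)
  have h3 := Finset.sum_le_sum fun i (_ : i ∈ Finset.univ) =>
    Finset.sum_le_sum fun j (_ : j ∈ Finset.univ.filter (· ≠ i)) =>
      sum_increment_exp_le hθ hone hM hM0 hs i j
  simp only [← Finset.mul_sum] at h3
  simp only [← sq] at h2
  rw [h1, h2] at h3
  linarith

end Decorrelation

/-! ### Tail bounds from a differential inequality for the moment generating function -/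

section Tails

variable {Ω : Type*} [MeasurableSpace Ω] {μ : Measure Ω}

lemma integrableExpSet_eq_univ_of_abs_le [IsFiniteMeasure μ] {Y : Ω → ℝ} (hY : Measurable Y)
    {C : ℝ} (hC : ∀ ω, |Y ω| ≤ C) : integrableExpSet Y μ = Set.univ :=
  Set.eq_univ_of_forall fun _ =>
    integrable_exp_mul_of_mem_Icc (a := -C) (b := C) hY.aemeasurable
      (ae_of_all _ fun ω => abs_le.1 (hC ω))

/-- Grönwall's argument: the product of the moment generating function with `e^{-Φ}` is
nonincreasing and starts at one. -/
lemma mgf_le_exp [IsProbabilityMeasure μ] {Y : Ω → ℝ} (hY : Measurable Y) {C : ℝ}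
    (hC : ∀ ω, |Y ω| ≤ C) {s : ℝ} (hs : 0 ≤ s) {Φ Φ' : ℝ → ℝ} (hΦ0 : Φ 0 = 0)
    (hΦ : ∀ u, HasDerivAt Φ (Φ' u) u)
    (h : ∀ u, 0 < u → u < s → ∫ ω, Y ω * Real.exp (u * Y ω) ∂μ ≤ Φ' u * mgf Y μ u) :
    mgf Y μ s ≤ Real.exp (Φ s) := by
  have hd : ∀ u, HasDerivAt (mgf Y μ) (∫ ω, Y ω * Real.exp (u * Y ω) ∂μ) u := fun u =>
    hasDerivAt_mgf (by rw [integrableExpSet_eq_univ_of_abs_le hY hC, interior_univ]; trivial)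
  have hg : ∀ u, HasDerivAt (fun u => mgf Y μ u * Real.exp (-Φ u))
      ((∫ ω, Y ω * Real.exp (u * Y ω) ∂μ) * Real.exp (-Φ u) +
        mgf Y μ u * (Real.exp (-Φ u) * -Φ' u)) u := fun u => (hd u).mul (hΦ u).neg.exp
  have hanti : AntitoneOn (fun u => mgf Y μ u * Real.exp (-Φ u)) (Set.Icc 0 s) := by
    refine antitoneOn_of_deriv_nonpos (convex_Icc 0 s)
      (fun u _ => (hg u).continuousAt.continuousWithinAt)
      (fun u _ => (hg u).differentiableAt.differentiableWithinAt) fun u hu => ?_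
    rw [interior_Icc] at hu
    rw [(hg u).deriv]
    have h1 := mul_le_mul_of_nonneg_right (h u hu.1 hu.2) (Real.exp_pos (-Φ u)).le
    linarith
  have h2 := hanti (Set.left_mem_Icc.2 hs) (Set.right_mem_Icc.2 hs) hs
  simp only [hΦ0, mgf_zero, neg_zero, Real.exp_zero, mul_one] at h2
  rw [Real.exp_neg, ← div_eq_mul_inv, div_le_one (Real.exp_pos _)] at h2
  exact h2

/-- Two Chernoff bounds under `m' ≤ (V u e^{cu} + b) m`. -/
lemma chernoff_of_mgf_deriv_le [IsProbabilityMeasure μ] {Y : Ω → ℝ} (hY : Measurable Y) {C : ℝ}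
    (hC : ∀ ω, |Y ω| ≤ C) {V c b s : ℝ} (hV : 0 ≤ V) (hc : 0 < c) (hs : 0 ≤ s)
    (h : ∀ u, 0 < u → u < s → ∫ ω, Y ω * Real.exp (u * Y ω) ∂μ ≤
      (V * u * Real.exp (c * u) + b) * mgf Y μ u) (t : ℝ) :
    μ.real {ω | t ≤ Y ω} ≤ Real.exp (-s * t + (b * s + V * Real.exp (c * s) * s ^ 2 / 2)) ∧
    μ.real {ω | t ≤ Y ω} ≤ Real.exp (-s * t + (b * s + V * s * Real.exp (c * s) / c)) := by
  have hch : μ.real {ω | t ≤ Y ω} ≤ Real.exp (-s * t) * mgf Y μ s :=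
    measure_ge_le_exp_mul_mgf t hs (by
      have := integrableExpSet_eq_univ_of_abs_le (μ := μ) hY hC
      exact (Set.eq_univ_iff_forall.1 this s))
  constructor
  · refine hch.trans ?_
    rw [Real.exp_add]
    refine mul_le_mul_of_nonneg_left ?_ (Real.exp_pos _).le
    -- The first bound freezes `e^{cu}` at `e^{cs}` before integrating; the second freezes the
    -- factor `u` at `s` instead.
    refine mgf_le_exp hY hC hs (Φ := fun u => b * u + V * Real.exp (c * s) * u ^ 2 / 2)
      (Φ' := fun u => b + V * Real.exp (c * s) * u) (by simp) (fun u => ?_) fun u hu hus => ?_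
    · have := ((hasDerivAt_id u).const_mul b).add
        (((hasDerivAt_id u).pow 2).const_mul (V * Real.exp (c * s) / 2))
      refine (this.congr_deriv ?_).congr_of_eventuallyEq (Filter.Eventually.of_forall fun x => ?_)
      · simp; ring
      · simp; ring
    · refine (h u hu hus).trans (mul_le_mul_of_nonneg_right ?_ mgf_nonneg)
      have : Real.exp (c * u) ≤ Real.exp (c * s) :=
        Real.exp_le_exp.2 (mul_le_mul_of_nonneg_left hus.le hc.le)
      have := mul_le_mul_of_nonneg_left this (mul_nonneg hV hu.le)
      linarith
  · refine hch.trans ?_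
    rw [Real.exp_add]
    refine mul_le_mul_of_nonneg_left ?_ (Real.exp_pos _).le
    have h2 : mgf Y μ s ≤ Real.exp (b * s + V * s / c * (Real.exp (c * s) - 1)) := by
      refine mgf_le_exp hY hC hs (Φ := fun u => b * u + V * s / c * (Real.exp (c * u) - 1))
        (Φ' := fun u => b + V * s * Real.exp (c * u)) (by simp) (fun u => ?_) fun u hu hus => ?_
      · have := ((hasDerivAt_id u).const_mul b).add
          ((((hasDerivAt_id u).const_mul c).exp.sub_const 1).const_mul (V * s / c))
        refine (this.congr_deriv ?_).congr_of_eventuallyEq (Filter.Eventually.of_forall fun x => ?_)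
        · simp; field_simp
        · simp
      · refine (h u hu hus).trans (mul_le_mul_of_nonneg_right ?_ mgf_nonneg)
        have := mul_le_mul_of_nonneg_right (mul_le_mul_of_nonneg_left hus.le hV)
          (Real.exp_pos (c * u)).le
        linarith
    refine h2.trans (Real.exp_le_exp.2 ?_)
    have : 0 ≤ V * s / c := by positivity
    have e : V * s * Real.exp (c * s) / c = V * s / c * Real.exp (c * s) := by ring
    rw [e]
    linarith

lemma log_log_le_half_log {x : ℝ} (hx : 1 < x) : Real.log (Real.log x) ≤ Real.log x / 2 := by
  have hL := Real.log_pos hx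
  have h1 := Real.log_le_sub_one_of_pos (half_pos hL)
  rw [Real.log_div hL.ne' two_ne_zero] at h1
  have := Real.log_two_lt_d9
  linarith

/-- A bounded statistic `Y` with bounded remainder `R` whose moment generating function satisfies
`m'(s) ≤ V s e^{cs} m(s) + E[R e^{sY}] / lam` for `s ≥ 0`. -/
structure SteinBound (μ : Measure Ω) (Y R : Ω → ℝ) (lam c V : ℝ) : Prop where
  measurable : Measurable Y
  exists_bound : ∃ C, ∀ ω, |Y ω| ≤ C
  exists_bound_remainder : ∃ K, ∀ᵐ ω ∂μ, |R ω| ≤ K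
  integrable : Integrable R μ
  integral_le : ∀ s, 0 ≤ s → ∫ ω, Y ω * Real.exp (s * Y ω) ∂μ ≤
    V * s * Real.exp (c * s) * mgf Y μ s + (∫ ω, R ω * Real.exp (s * Y ω) ∂μ) / lam

lemma integral_condExp_mul [IsProbabilityMeasure μ] {Y R f : Ω → ℝ} (hY : Measurable Y)
    (hR : Integrable R μ) (hf : StronglyMeasurable[MeasurableSpace.comap Y inferInstance] f)
    {C : ℝ} (hC : ∀ ω, |f ω| ≤ C) :
    ∫ ω, (μ[R | MeasurableSpace.comap Y inferInstance]) ω * f ω ∂μ = ∫ ω, R ω * f ω ∂μ := by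
  have hm : MeasurableSpace.comap Y inferInstance ≤ (inferInstance : MeasurableSpace Ω) :=
    hY.comap_le
  have hint : Integrable (R * f) μ :=
    hR.mul_bdd (hf.mono hm).aestronglyMeasurable (ae_of_all _ hC)
  have h1 := condExp_mul_of_stronglyMeasurable_right hf hint hR
  exact (integral_congr_ae h1).symm.trans (integral_condExp hm)

lemma stronglyMeasurable_comap_comp {Ω : Type*} {Y : Ω → ℝ} {g : ℝ → ℝ} (hg : Measurable g) :
    StronglyMeasurable[MeasurableSpace.comap Y inferInstance] fun ω => g (Y ω) :=
  (hg.comp (comap_measurable Y)).stronglyMeasurable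

lemma exp_mul_le_of_abs_le {y C s : ℝ} (h : |y| ≤ C) : |Real.exp (s * y)| ≤ Real.exp (|s| * C) := by
  rw [abs_of_pos (Real.exp_pos _), Real.exp_le_exp]
  refine (le_abs_self _).trans ?_
  rw [abs_mul]
  exact mul_le_mul_of_nonneg_left h (abs_nonneg s)

lemma isCoboundedUnder_abs [NeZero μ] (f : Ω → ℝ) :
    Filter.IsCoboundedUnder (· ≤ ·) (ae μ) fun ω => |f ω| :=
  Filter.IsBoundedUnder.isCoboundedUnder_le
    ⟨0, Filter.eventually_map.2 (ae_of_all _ fun _ => abs_nonneg _)⟩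

/-- The essential supremum controls the remainder for every `u`; the range matters only under
negative correlation. Hence `hα` is an implication, which is what makes the self-referential range
in `B1log` usable. -/
lemma SteinBound.integral_remainder_le [IsProbabilityMeasure μ] {Y R : Ω → ℝ} {lam c V : ℝ}
    (h : SteinBound μ Y R lam c V) (hlam : 0 < lam) {α u : ℝ} (hu : 0 < u)
    (hα : NegCorr μ Y R α → u < α) :
    (∫ ω, R ω * Real.exp (u * Y ω) ∂μ) / lam ≤ B1 μ Y R lam α * mgf Y μ u := by
  obtain ⟨C, hC⟩ := h.exists_bound
  obtain ⟨K, hK⟩ := h.exists_bound_remainder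
  have hexpm : Measurable fun ω => Real.exp (u * Y ω) :=
    Real.measurable_exp.comp (h.measurable.const_mul u)
  have hexpC : ∀ ω, |Real.exp (u * Y ω)| ≤ Real.exp (|u| * C) := fun ω =>
    exp_mul_le_of_abs_le (hC ω)
  have hint : ∀ f : Ω → ℝ, Integrable f μ → Integrable (fun ω => f ω * Real.exp (u * Y ω)) μ :=
    fun f hf => hf.mul_bdd hexpm.aestronglyMeasurable (ae_of_all _ hexpC)
  rw [B1]
  split_ifs with hneg
  · rw [div_mul_eq_mul_div, div_le_div_iff_of_pos_right hlam]
    have hcov := hneg u hu (hα hneg)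
    rw [covariance_eq_sub
      (MemLp.of_bound h.integrable.abs.aestronglyMeasurable K (by simpa using hK))
      (MemLp.of_bound hexpm.aestronglyMeasurable _ (ae_of_all _ hexpC))] at hcov
    have h1 : ∫ ω, R ω * Real.exp (u * Y ω) ∂μ ≤ ∫ ω, |R ω| * Real.exp (u * Y ω) ∂μ :=
      integral_mono (hint R h.integrable) (hint _ h.integrable.abs) fun ω =>
        mul_le_mul_of_nonneg_right (le_abs_self _) (Real.exp_pos _).le
    have h2 : ∫ ω, |R ω| * Real.exp (u * Y ω) ∂μ ≤ (∫ ω, |R ω| ∂μ) * mgf Y μ u := by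
      simp only [Pi.mul_apply] at hcov
      rw [mgf]
      linarith
    exact h1.trans h2
  · rw [div_mul_eq_mul_div, div_le_div_iff_of_pos_right hlam]
    have hbdd := ae_bdd_abs_condExp_of_ae_bdd_abs (m := MeasurableSpace.comap Y inferInstance) hK
    have hess := ae_le_essSup (μ := μ)
      (f := fun ω => |(μ[R | MeasurableSpace.comap Y inferInstance]) ω|)
      ⟨_, Filter.eventually_map.2 hbdd⟩
    have hpull := integral_condExp_mul h.measurable h.integrable
      (stronglyMeasurable_comap_comp (Y := Y)
        (Real.measurable_exp.comp (measurable_id.const_mul u))) hexpC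
    simp only [Function.comp_apply, id_eq] at hpull
    rw [← hpull, mgf, ← integral_const_mul]
    refine integral_mono_ae (hint _ integrable_condExp)
      ((integrable_const _).mul_bdd hexpm.aestronglyMeasurable (ae_of_all _ hexpC)) ?_
    filter_upwards [hess] with ω hω
    exact mul_le_mul_of_nonneg_right ((le_abs_self _).trans hω) (Real.exp_pos _).le

lemma B1_le_of_ae_abs_le [IsProbabilityMeasure μ] {Y R : Ω → ℝ} {lam K : ℝ} (hlam : 0 < lam)
    (hR : Integrable R μ) (hK : ∀ᵐ ω ∂μ, |R ω| ≤ K) (α : ℝ) : B1 μ Y R lam α ≤ K / lam := by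
  rw [B1]
  split_ifs
  · rw [div_le_div_iff_of_pos_right hlam]
    exact (integral_mono_ae hR.abs (integrable_const K) hK).trans_eq (by simp)
  · rw [div_le_div_iff_of_pos_right hlam]
    have hbdd := ae_bdd_abs_condExp_of_ae_bdd_abs (m := MeasurableSpace.comap Y inferInstance) hK
    exact essSup_le_of_ae_le K hbdd (isCoboundedUnder_abs _)

lemma SteinBound.mgf_deriv_le [IsProbabilityMeasure μ] {Y R : Ω → ℝ} {lam c V : ℝ}
    (h : SteinBound μ Y R lam c V) (hlam : 0 < lam) {α u : ℝ} (hu : 0 < u)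
    (hα : NegCorr μ Y R α → u < α) :
    ∫ ω, Y ω * Real.exp (u * Y ω) ∂μ ≤
      (V * u * Real.exp (c * u) + B1 μ Y R lam α) * mgf Y μ u := by
  have h1 := h.integral_le u hu.le
  have h2 := h.integral_remainder_le hlam hu hα
  linarith

/-! ### Choices of the Chernoff exponent -/

variable [IsProbabilityMeasure μ] {Y R : Ω → ℝ} {lam c V : ℝ}

theorem SteinBound.measure_ge_le (h : SteinBound μ Y R lam c V) (hlam : 0 < lam) (hc : 0 < c)
    (hV : 0 < V) {t : ℝ} (ht : 0 < t) :
    μ.real {ω | t ≤ Y ω} ≤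
      Real.exp (-(t * (t - 2 * B1 μ Y R lam (1 / c)) / (2 * (V + c * t)))) := by
  obtain ⟨C, hC⟩ := h.exists_bound
  have hD : 0 < V + c * t := by positivity
  set s := t / (V + c * t) with hs
  have hs0 : 0 < s := by positivity
  have hcs : c * s = 1 - V / (V + c * t) := by rw [hs]; field_simp; ring
  have hs1 : s < 1 / c := by
    rw [lt_div_iff₀ hc, mul_comm, hcs]
    have : 0 < V / (V + c * t) := by positivity
    linarith
  refine (chernoff_of_mgf_deriv_le h.measurable hC hV.le hc hs0.le
    (fun u hu hus => h.mgf_deriv_le hlam hu fun _ => hus.trans hs1) t).1.trans ?_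
  set b := B1 μ Y R lam (1 / c)
  rw [Real.exp_le_exp]
  -- This is `e^{-cs} ≥ 1 - cs = V / (V + ct)`. The exponent then becomes at most `-st/2 + bs`.
  have he : V * Real.exp (c * s) ≤ V + c * t := by
    have h1 := Real.add_one_le_exp (-(c * s))
    have hpos : 0 < -(1 - V / (V + c * t)) + 1 := by
      rw [neg_sub, sub_add_cancel]; positivity
    rw [Real.exp_neg, hcs, le_inv_comm₀ hpos (Real.exp_pos _)] at h1
    have h2 : (-(1 - V / (V + c * t)) + 1)⁻¹ = (V + c * t) / V := by
      rw [neg_sub, sub_add_cancel, inv_div]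
    rw [h2, le_div_iff₀ hV] at h1
    rw [hcs]
    linarith
  have e1 : t * (t - 2 * b) / (2 * (V + c * t)) = s * (t - 2 * b) / 2 := by
    rw [hs]; field_simp
  have e2 : s * (V + c * t) = t := by rw [hs]; field_simp
  rw [e1]
  have h3 : V * Real.exp (c * s) * s ^ 2 ≤ (V + c * t) * s ^ 2 :=
    mul_le_mul_of_nonneg_right he (sq_nonneg s)
  have h4 : (V + c * t) * s ^ 2 = t * s := by linear_combination s * e2
  linarith

theorem SteinBound.measure_ge_le' (h : SteinBound μ Y R lam c V) (hlam : 0 < lam) (hc : 0 < c)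
    (hV : 0 < V) {t : ℝ} (ht : 0 < t) :
    μ.real {ω | t ≤ Y ω} ≤
      Real.exp (-(t * (t - 2 * B1 μ Y R lam (2 / c)) / (10 * V / 3 + c * t))) := by
  obtain ⟨C, hC⟩ := h.exists_bound
  set D := 10 * V / 3 + c * t with hDdef
  have hD : 0 < D := by positivity
  set s := 2 * t / D with hs
  have hs0 : 0 < s := by positivity
  have hcs : (2 - c * s) * D = 20 * V / 3 := by rw [hs]; field_simp; rw [hDdef]; ring
  have hlt : c * s < 2 := by
    have : 0 < (2 - c * s) * D := by rw [hcs]; positivity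
    have := pos_of_mul_pos_left this hD.le
    linarith
  have hs1 : s < 2 / c := by rw [lt_div_iff₀ hc]; linarith
  refine (chernoff_of_mgf_deriv_le h.measurable hC hV.le hc hs0.le
    (fun u hu hus => h.mgf_deriv_le hlam hu fun _ => hus.trans hs1) t).1.trans ?_
  set b := B1 μ Y R lam (2 / c)
  rw [Real.exp_le_exp]
  -- From `e^{1-cs} ≥ 2 - cs` one gets `(2 - cs) e^{cs} ≤ e ≤ 2.72`; with `(2 - cs) D = 20V/3` this
  -- gives `V e^{cs} ≤ 0.408 D`.
  have he : V * Real.exp (c * s) ≤ D / 2 := by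
    have h1 := Real.add_one_le_exp (1 - c * s)
    have h2 : (2 - c * s) * Real.exp (c * s) ≤ 2.72 := by
      have h3 : (1 - c * s + 1) * Real.exp (c * s) ≤
          Real.exp (1 - c * s) * Real.exp (c * s) :=
        mul_le_mul_of_nonneg_right h1 (Real.exp_pos _).le
      rw [← Real.exp_add, sub_add_cancel] at h3
      have := Real.exp_one_lt_d9
      norm_num at this ⊢
      linarith
    have h5 : (2 - c * s) * Real.exp (c * s) * D ≤ 2.72 * D :=
      mul_le_mul_of_nonneg_right h2 hD.le
    have h6 : (2 - c * s) * Real.exp (c * s) * D = 20 / 3 * (V * Real.exp (c * s)) := by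
      linear_combination Real.exp (c * s) * hcs
    rw [h6] at h5
    norm_num at h5
    linarith
  have e1 : t * (t - 2 * b) / D = s * (t - 2 * b) / 2 := by
    rw [hs]; field_simp
  have e2 : s * D = 2 * t := by rw [hs]; field_simp
  rw [e1]
  have h3 : V * Real.exp (c * s) * s ^ 2 ≤ D / 2 * s ^ 2 :=
    mul_le_mul_of_nonneg_right he (sq_nonneg s)
  have h4 : D / 2 * s ^ 2 = t * s := by linear_combination s / 2 * e2
  linarith

theorem SteinBound.measure_ge_le_log (h : SteinBound μ Y R lam c V) (hlam : 0 < lam) (hc : 0 < c)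
    (hV : 0 < V) {t b : ℝ} (hb : b = B1log μ Y R lam c t) (hbt : b < t) :
    μ.real {ω | t ≤ Y ω} ≤
        Real.exp (-((t - b) / (2 * c) * (Real.log (t - b) - 2 * V / c))) ∧
      (b + Real.exp 1 < t →
        μ.real {ω | t ≤ Y ω} ≤ Real.exp (-((t - b) / c *
          (Real.log (t - b) - Real.log (Real.log (t - b)) - V / c))) ∧
        Real.exp (-((t - b) / c *
          (Real.log (t - b) - Real.log (Real.log (t - b)) - V / c))) ≤
          Real.exp (-((t - b) / (2 * c) * (Real.log (t - b) - 2 * V / c)))) := by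
  obtain ⟨C, hC⟩ := h.exists_bound
  set x := t - b with hx
  have hx0 : 0 < x := sub_pos.2 hbt
  -- Under negative correlation `b` equals `E|R| / lam`, so the `α` in `B1log` is exactly the one
  -- formed from `t - b`.
  have hα : 1 < x → ∀ u, 0 < u → u < (Real.log x - Real.log (Real.log x)) / c →
      ∫ ω, Y ω * Real.exp (u * Y ω) ∂μ ≤ (V * u * Real.exp (c * u) + b) * mgf Y μ u := by
    intro hx1 u hu hus
    rw [hb]
    refine h.mgf_deriv_le hlam hu fun hneg => ?_
    have hb' : b = (∫ ω, |R ω| ∂μ) / lam := by rw [hb, B1log, B1, if_pos hneg]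
    rw [← hb', ← hx, logAlpha, if_pos hx1]
    exact hus
  have hlast : 1 < x → -(x / c * (Real.log x - Real.log (Real.log x) - V / c)) ≤
      -(x / (2 * c) * (Real.log x - 2 * V / c)) := by
    intro hx1
    have h1 := log_log_le_half_log hx1
    have h2 : x / (2 * c) * (Real.log x - 2 * V / c) = x / c * (Real.log x / 2 - V / c) := by
      field_simp
    rw [h2, neg_le_neg_iff]
    exact mul_le_mul_of_nonneg_left (by linarith) (by positivity)
  refine ⟨?_, fun hbe => ?_⟩
  · by_cases hlog : Real.log x ≤ 2 * V / c
    · refine measureReal_le_one.trans (Real.one_le_exp ?_)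
      rw [neg_nonneg]
      exact mul_nonpos_of_nonneg_of_nonpos (by positivity) (by linarith)
    · rw [not_le] at hlog
      have hL : 0 < Real.log x := lt_trans (by positivity) hlog
      have hx1 : 1 < x := (Real.log_pos_iff hx0.le).1 hL
      -- With `s = y / c` one has `e^{cs} = √x`, and `y² ≤ 2 e^y` absorbs the factor `s²`. The
      -- complementary case is trivial, since the bound is then at least one.
      set y := Real.log x / 2 with hy
      have hy0 : 0 < y := half_pos hL
      have hcs : c * (y / c) = y := by field_simp
      have hs : y / c ≤ (Real.log x - Real.log (Real.log x)) / c := by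
        rw [div_le_div_iff_of_pos_right hc]
        linarith [log_log_le_half_log hx1]
      refine (chernoff_of_mgf_deriv_le h.measurable hC hV.le hc (s := y / c) (by positivity)
        (fun u hu hus => hα hx1 u hu (hus.trans_le hs)) t).1.trans ?_
      rw [Real.exp_le_exp, hcs]
      have hxy : x = Real.exp y * Real.exp y := by
        rw [← Real.exp_add, hy, add_halves, Real.exp_log hx0]
      have hq : Real.exp y * y ^ 2 ≤ 2 * x := by
        have h1 := Real.quadratic_le_exp_of_nonneg hy0.le
        have h2 : y ^ 2 ≤ 2 * Real.exp y := by linarith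
        rw [hxy]
        have := mul_le_mul_of_nonneg_left h2 (Real.exp_pos y).le
        linarith
      have e1 : x / (2 * c) * (Real.log x - 2 * V / c) = y / c * x - V * x / c ^ 2 := by
        rw [hy]; field_simp
      have e2 : V * Real.exp y * (y / c) ^ 2 / 2 = V / (2 * c ^ 2) * (Real.exp y * y ^ 2) := by
        field_simp
      have e3 : V * x / c ^ 2 = V / (2 * c ^ 2) * (2 * x) := by field_simp
      have h4 := mul_le_mul_of_nonneg_left hq (show 0 ≤ V / (2 * c ^ 2) by positivity)
      have e4 : y / c * x = y / c * t - b * (y / c) := by rw [hx]; ring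
      rw [e1, e2, e3, e4]
      linarith
  · have hxe : Real.exp 1 < x := by linarith
    have hx1 : 1 < x := lt_trans (by have := Real.add_one_le_exp 1; linarith) hxe
    refine ⟨?_, Real.exp_le_exp.2 (hlast hx1)⟩
    have hL : 1 < Real.log x := (Real.lt_log_iff_exp_lt hx0).2 hxe
    have hL0 : 0 < Real.log x := by linarith
    have hl : 0 < Real.log (Real.log x) := Real.log_pos hL
    set s := (Real.log x - Real.log (Real.log x)) / c with hs
    have hcs : c * s = Real.log x - Real.log (Real.log x) := by rw [hs]; field_simp
    have hs0 : 0 ≤ s := by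
      have := log_log_le_half_log hx1
      exact div_nonneg (by linarith) hc.le
    refine (chernoff_of_mgf_deriv_le h.measurable hC hV.le hc hs0
      (fun u hu hus => hα hx1 u hu hus) t).2.trans ?_
    rw [Real.exp_le_exp]
    -- The subtracted `log log x` makes `s e^{cs} ≤ x / c`, since `cs ≤ log x`.
    have he : Real.exp (c * s) = x / Real.log x := by
      rw [hcs, Real.exp_sub, Real.exp_log hx0, Real.exp_log hL0]
    have e1 : x / c * (Real.log x - Real.log (Real.log x) - V / c) = s * x - V * x / c ^ 2 := by
      rw [hs]; field_simp
    have h2 : V * s * Real.exp (c * s) / c ≤ V * x / c ^ 2 := by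
      rw [he]
      have h3 : c * s ≤ Real.log x := by linarith
      have e2 : V * s * (x / Real.log x) / c = V * x / c ^ 2 * (c * s / Real.log x) := by
        field_simp
      rw [e2]
      exact mul_le_of_le_one_right (by positivity) ((div_le_one hL0).2 h3)
    have e4 : s * x = s * t - b * s := by rw [hx]; ring
    rw [e1, e4]
    linarith

end Tails

/-! ### The remainder and the Ewens permutation -/

section Remainder

variable {n : ℕ}

lemma hoeffding_neg (a : Matrix (Fin n) (Fin n) ℝ) (σ : Equiv.Perm (Fin n)) :
    hoeffding (-a) σ = -hoeffding a σ := by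
  simp [hoeffding]

lemma remainderT_neg (θ : ℝ) (a : Matrix (Fin n) (Fin n) ℝ) (σ : Equiv.Perm (Fin n)) :
    remainderT θ (-a) σ = -remainderT θ a σ := by
  simp only [remainderT, Matrix.neg_apply, Finset.sum_neg_distrib]
  ring

lemma hoeffding_centredArray (θ : ℝ) (A : Matrix (Fin n) (Fin n) ℝ) (σ : Equiv.Perm (Fin n)) :
    hoeffding (centredArray θ A) σ = hoeffding A σ - n * meanEntry θ A := by
  simp [hoeffding, centredArray, Finset.sum_sub_distrib]

lemma centredArray_mean_zero {θ : ℝ} (hθ : 0 < θ) (hn : 2 ≤ n) (A : Matrix (Fin n) (Fin n) ℝ) :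
    θ * ∑ i, centredArray θ A i i + ∑ i, ∑ j with j ≠ i, centredArray θ A i j = 0 := by
  have h1 := (one_lt_pos_of_two_le hθ hn).1
  have hn0 : (n : ℝ) ≠ 0 := by
    have : n ≠ 0 := by omega
    exact_mod_cast this
  have h2 : meanEntry θ A * (n * (θ + n - 1)) =
      θ * ∑ i, A i i + ∑ i, ∑ j with j ≠ i, A i j := by
    rw [meanEntry, div_mul_cancel₀ _ (by positivity)]
  simp only [centredArray, Finset.sum_sub_distrib, Finset.filter_ne', Finset.sum_const,
    Finset.card_erase_of_mem (Finset.mem_univ _), Finset.card_univ, Fintype.card_fin,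
    nsmul_eq_mul] at h2 ⊢
  rw [Nat.cast_pred (by omega)]
  linear_combination -h2

lemma abs_centredArray_le (θ : ℝ) (A : Matrix (Fin n) (Fin n) ℝ) (i j : Fin n) :
    |centredArray θ A i j| ≤ maxDev θ A :=
  le_ciSup (f := fun p : Fin n × Fin n => |A p.1 p.2 - meanEntry θ A|)
    (Set.finite_range _).bddAbove (i, j)

lemma abs_sum_le_card_mul {ι : Type*} (s : Finset ι) (f : ι → ℝ) {M : ℝ}
    (h : ∀ i ∈ s, |f i| ≤ M) : |∑ i ∈ s, f i| ≤ s.card * M := by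
  refine (Finset.abs_sum_le_sum_abs _ _).trans ?_
  rw [← nsmul_eq_mul]
  exact Finset.sum_le_card_nsmul _ _ _ h

/-- In the sum of the four termwise bounds the quadratic terms in the number of fixed points cancel.
Linearity lets first and second moments of that number suffice later. -/
lemma abs_remainderT_le {θ M : ℝ} (hθ : 0 < θ) (hn : 2 ≤ n) {a : Matrix (Fin n) (Fin n) ℝ}
    (hM : ∀ i j, |a i j| ≤ M) (σ : Equiv.Perm (Fin n)) :
    |remainderT θ a σ| ≤ M * (8 * (n - 1) * numFixed σ + 4 * θ * n) := by
  set f := (numFixed σ : ℝ) with hf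
  have hn2 : (2 : ℝ) ≤ n := by exact_mod_cast hn
  have hf0 : 0 ≤ f := Nat.cast_nonneg _
  have hcard : ((Finset.univ.filter fun i => σ i = i).card : ℝ) = f := rfl
  have hcard' : ((Finset.univ.filter fun i => σ i ≠ i).card : ℝ) = n - f := by
    have h := Finset.card_filter_add_card_filter_not (s := Finset.univ) (fun i => σ i = i)
    rw [Finset.card_univ, Fintype.card_fin] at h
    have h' : ((Finset.univ.filter fun i => σ i = i).card : ℝ) +
      (Finset.univ.filter fun i => ¬ σ i = i).card = n := by exact_mod_cast h
    rw [hcard] at h'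
    linarith
  have hfn : 0 ≤ n - f := hcard' ▸ Nat.cast_nonneg _
  have h1 : |∑ i with σ i = i, a i i| ≤ f * M := abs_sum_le_card_mul _ _ fun i _ => hM i i
  have h2 : |∑ i with σ i ≠ i, a i i| ≤ (n - f) * M :=
    hcard' ▸ abs_sum_le_card_mul _ _ fun i _ => hM i i
  have h3 : |∑ i with σ i = i, ∑ j with σ j = j ∧ j ≠ i, a i j| ≤ f * ((f - 1) * M) := by
    refine abs_sum_le_card_mul _ _ fun i hi => ?_
    have hset : (Finset.univ.filter fun j => σ j = j ∧ j ≠ i) =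
        (Finset.univ.filter fun j => σ j = j).erase i := by
      ext j; simp [and_comm]
    have hc : ((Finset.univ.filter fun j => σ j = j ∧ j ≠ i).card : ℝ) = f - 1 := by
      rw [hset, Finset.card_erase_of_mem hi, Nat.cast_pred (Finset.card_pos.2 ⟨i, hi⟩), hcard]
    rw [← hc]
    exact abs_sum_le_card_mul _ _ fun j _ => hM i j
  have h4 : |∑ i with σ i = i, ∑ j with σ j ≠ j, a i j| ≤ f * ((n - f) * M) := by
    refine abs_sum_le_card_mul _ _ fun i _ => ?_
    rw [← hcard']
    exact abs_sum_le_card_mul _ _ fun j _ => hM i j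
  have e1 : |2 * (n + f - 2 * (θ + 1)) * (∑ i with σ i = i, a i i)| ≤
      2 * (n + f - 2 + 2 * θ) * (f * M) := by
    rw [abs_mul]
    refine mul_le_mul ?_ h1 (abs_nonneg _) (by nlinarith)
    rw [abs_le]
    constructor <;> linarith
  have e2 : |2 * (f - 2 * θ) * (∑ i with σ i ≠ i, a i i)| ≤
      2 * (f + 2 * θ) * ((n - f) * M) := by
    rw [abs_mul]
    refine mul_le_mul ?_ h2 (abs_nonneg _) (by positivity)
    rw [abs_le]
    constructor <;> linarith
  have e3 := abs_le.1 e1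
  have e4 := abs_le.1 e2
  have e5 := abs_le.1 h3
  have e6 := abs_le.1 h4
  rw [remainderT, ← hf, abs_le]
  constructor <;> linarith

lemma sum_weight_mul_mul_le {ι : Type*} [Fintype ι] {p : ι → ℝ} (hp : ∀ i, 0 ≤ p i)
    (f g : ι → ℝ) :
    ∑ i, p i * (f i * g i) ≤ √(∑ i, p i * f i ^ 2) * √(∑ i, p i * g i ^ 2) := by
  have h := Real.sum_mul_le_sqrt_mul_sqrt Finset.univ (fun i => √(p i) * f i)
    (fun i => √(p i) * g i)
  simp only [mul_pow, Real.sq_sqrt (hp _)] at h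
  refine le_trans (Finset.sum_le_sum fun i _ => le_of_eq ?_) h
  rw [mul_mul_mul_comm, Real.mul_self_sqrt (hp i)]

end Remainder

/-! ### Transfer from weighted sums over permutations to the probability space -/

section Law

variable {Ω : Type*} [MeasurableSpace Ω] {μ : Measure Ω} {n : ℕ} {θ : ℝ}
  {π : Ω → Equiv.Perm (Fin n)}

/-- Measurability of `π` is given only through the events `π = σ`, so functions of `π` are treated
as finite sums of indicators. -/
lemma comp_eq_sum_indicator {Ω : Type*} {π : Ω → Equiv.Perm (Fin n)}
    (g : Equiv.Perm (Fin n) → ℝ) :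
    (fun ω => g (π ω)) = fun ω => ∑ σ, Set.indicator {ω | π ω = σ} (fun _ => g σ) ω := by
  ext ω
  simp [Set.indicator_apply]

lemma HasEwensLaw.measurable_comp (h : HasEwensLaw μ θ π) (g : Equiv.Perm (Fin n) → ℝ) :
    Measurable fun ω => g (π ω) := by
  rw [comp_eq_sum_indicator]
  exact Finset.measurable_sum _ fun σ _ => measurable_const.indicator (h σ).1

lemma abs_comp_le_sum {Ω : Type*} {π : Ω → Equiv.Perm (Fin n)} (g : Equiv.Perm (Fin n) → ℝ)
    (ω : Ω) : |g (π ω)| ≤ ∑ σ, |g σ| :=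
  Finset.single_le_sum (f := fun σ => |g σ|) (fun _ _ => abs_nonneg _) (Finset.mem_univ (π ω))

lemma HasEwensLaw.integrable_comp [IsFiniteMeasure μ] (h : HasEwensLaw μ θ π)
    (g : Equiv.Perm (Fin n) → ℝ) : Integrable (fun ω => g (π ω)) μ :=
  Integrable.of_bound (h.measurable_comp g).aestronglyMeasurable (∑ σ, |g σ|)
    (ae_of_all _ fun ω => abs_comp_le_sum g ω)

lemma HasEwensLaw.integral_comp [IsFiniteMeasure μ] (h : HasEwensLaw μ θ π) (hθ : 0 < θ)
    (g : Equiv.Perm (Fin n) → ℝ) : ∫ ω, g (π ω) ∂μ = ∑ σ, ewensProb θ σ * g σ := by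
  rw [comp_eq_sum_indicator, integral_finsetSum _ fun σ _ =>
    (integrable_const _).indicator (h σ).1]
  refine Finset.sum_congr rfl fun σ _ => ?_
  rw [integral_indicator_const _ (h σ).1, measureReal_def, (h σ).2,
    ENNReal.toReal_ofReal (ewensProb_pos hθ σ).le, smul_eq_mul]

lemma HasEwensLaw.sum_eq_one [IsProbabilityMeasure μ] (h : HasEwensLaw μ θ π) (hθ : 0 < θ) :
    ∑ σ : Equiv.Perm (Fin n), ewensProb θ σ = 1 := by
  have := h.integral_comp hθ (fun _ => 1)
  simpa using this.symm

/-- The differential inequality for a statistic whose remainder has the conditional moments of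
`T / (n (n - 1))`. -/
lemma HasEwensLaw.steinBound [IsProbabilityMeasure μ] (h : HasEwensLaw μ θ π) (hθ : 0 < θ)
    (hn : 2 ≤ n) {a : Matrix (Fin n) (Fin n) ℝ} (ha : ∀ i j, a i j = a j i)
    (h0 : θ * ∑ i, a i i + ∑ i, ∑ j with j ≠ i, a i j = 0) {M : ℝ} (hM : ∀ i j, |a i j| ≤ M)
    (hM0 : 0 ≤ M) {Y R : Ω → ℝ} (hY : ∀ ω, Y ω = hoeffding a (π ω)) (hR : Integrable R μ)
    (hRK : ∃ K, ∀ᵐ ω ∂μ, |R ω| ≤ K)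
    -- Testing `R` against functions of `Y` replaces its definition as a conditional expectation, so
    -- the pair `(-Y, -R)` is covered without comparing σ-algebras.
    (hRY : ∀ g : ℝ → ℝ, Measurable g → ∫ ω, R ω * g (Y ω) ∂μ =
      (∑ σ, ewensProb θ σ * (remainderT θ a σ * g (hoeffding a σ))) / (n * (n - 1)))
    {V : ℝ} (hV : ∫ ω, Y ω ^ 2 ∂μ + |∫ ω, Y ω * R ω ∂μ| / (4 / n) ≤ V) :
    SteinBound μ Y R (4 / n) (20 * M) V := by
  have hn2 : (2 : ℝ) ≤ n := by exact_mod_cast hn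
  have hY' : Y = fun ω => hoeffding a (π ω) := funext hY
  have hq : (0 : ℝ) < 4 * (n - 1) := by linarith
  have hdiv : ∀ x : ℝ, x / (n * (n - 1)) / (4 / n) = x / (4 * (n - 1)) := by
    intro x
    have : (n : ℝ) - 1 ≠ 0 := by linarith
    field_simp
  refine ⟨?_, ⟨∑ σ, |hoeffding a σ|, fun ω => ?_⟩, hRK, hR, fun s hs => ?_⟩
  · rw [hY']; exact h.measurable_comp _
  · rw [hY]; exact abs_comp_le_sum (hoeffding a) ω
  have hcore := sum_hoeffding_mul_exp_le hθ (h.sum_eq_one hθ) ha h0 hM hM0 hs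
  have e1 : ∫ ω, Y ω * Real.exp (s * Y ω) ∂μ =
      ∑ σ, ewensProb θ σ * (hoeffding a σ * Real.exp (s * hoeffding a σ)) := by
    rw [hY']; exact h.integral_comp hθ fun σ => hoeffding a σ * Real.exp (s * hoeffding a σ)
  have e2 : mgf Y μ s = ∑ σ, ewensProb θ σ * Real.exp (s * hoeffding a σ) := by
    rw [mgf, hY']; exact h.integral_comp hθ fun σ => Real.exp (s * hoeffding a σ)
  have e3 : ∫ ω, Y ω ^ 2 ∂μ = ∑ σ, ewensProb θ σ * hoeffding a σ ^ 2 := by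
    rw [hY']; exact h.integral_comp hθ fun σ => hoeffding a σ ^ 2
  have e4 := hRY (fun y => Real.exp (s * y))
    (Real.measurable_exp.comp (measurable_id.const_mul s))
  have e5 := hRY (fun y => y) measurable_id
  set m := ∑ σ, ewensProb θ σ * Real.exp (s * hoeffding a σ) with hm
  set X := ∑ σ, ewensProb θ σ * (hoeffding a σ * Real.exp (s * hoeffding a σ)) with hX
  set Te := ∑ σ, ewensProb θ σ * (remainderT θ a σ * Real.exp (s * hoeffding a σ)) with hTe
  set Ts := ∑ σ, ewensProb θ σ * (remainderT θ a σ * hoeffding a σ) with hTs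
  set W := ∑ σ, ewensProb θ σ * hoeffding a σ ^ 2 with hW
  have c1 : ∑ σ, ewensProb θ σ * (Real.exp (s * hoeffding a σ) *
      (4 * (n - 1) * hoeffding a σ - remainderT θ a σ)) = 4 * (n - 1) * X - Te := by
    rw [hX, hTe, Finset.mul_sum, ← Finset.sum_sub_distrib]
    exact Finset.sum_congr rfl fun σ _ => by ring
  have c2 : ∑ σ, ewensProb θ σ * (hoeffding a σ *
      (4 * (n - 1) * hoeffding a σ - remainderT θ a σ)) = 4 * (n - 1) * W - Ts := by
    rw [hW, hTs, Finset.mul_sum, ← Finset.sum_sub_distrib]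
    exact Finset.sum_congr rfl fun σ _ => by ring
  rw [c1, c2] at hcore
  have hm0 : 0 ≤ m := Finset.sum_nonneg fun σ _ =>
    mul_nonneg (ewensProb_pos hθ σ).le (Real.exp_pos _).le
  have hVge : W - Ts / (4 * (n - 1)) ≤ V := by
    refine le_trans ?_ hV
    simp only [mul_comm (Y _)]
    rw [e3, e5]
    have habs := neg_abs_le (Ts / (n * (n - 1)) / (4 / n))
    rw [abs_div _ (4 / (n : ℝ)), abs_of_pos (show (0 : ℝ) < 4 / n by positivity), hdiv] at habs
    linarith
  rw [e1, e2, e4, hdiv]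
  have h5 : X - Te / (4 * (n - 1)) ≤
      s * Real.exp (20 * M * s) * m * (W - Ts / (4 * (n - 1))) := by
    have h6 := div_le_div_of_nonneg_right hcore hq.le
    have e6 : (4 * (n - 1) * X - Te) / (4 * (n - 1)) = X - Te / (4 * (n - 1)) := by
      rw [sub_div, mul_div_cancel_left₀ _ hq.ne']
    have e7 : s * Real.exp (20 * M * s) * m * (4 * (n - 1) * W - Ts) / (4 * (n - 1)) =
        s * Real.exp (20 * M * s) * m * (W - Ts / (4 * (n - 1))) := by
      rw [mul_div_assoc, sub_div, mul_div_cancel_left₀ _ hq.ne']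
    rwa [e6, e7] at h6
  have h7 := mul_le_mul_of_nonneg_left hVge
    (show 0 ≤ s * Real.exp (20 * M * s) * m by positivity)
  linarith

end Law

/-! ### The concentration inequalities and the explicit constants -/

theorem theorem2p1 {Ω : Type*} [MeasurableSpace Ω] (μ : Measure Ω) [IsProbabilityMeasure μ]
    (n : ℕ) (hn : 6 ≤ n) (θ : ℝ) (hθ : 0 < θ)
    (A : Matrix (Fin n) (Fin n) ℝ) (hA : ∀ i j, A i j = A j i)
    (π : Ω → Equiv.Perm (Fin n)) (hπ : HasEwensLaw μ θ π)
    -- the centred statistic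
    (Y : Ω → ℝ) (hY : Y = fun ω => hoeffding A (π ω) - ∫ ω', hoeffding A (π ω') ∂μ)
    (hvar : 0 < Var[Y; μ])
    (R : Ω → ℝ) (hR : R = remainder μ θ A π Y)
    (lam : ℝ) (hlam : lam = 4 / n)
    (M : ℝ) (hM : M = maxDev θ A)
    (c : ℝ) (hc : c = 20 * M)
    (V : ℝ) (hV : V = Var[Y; μ] + B2 μ Y R lam) :
    -- `R` is the remainder of the approximate Stein pair
    (μ[fun ω => conjMean A (π ω) - ∫ ω', hoeffding A (π ω') ∂μ |
        MeasurableSpace.comap Y inferInstance] =ᵐ[μ] fun ω => (1 - lam) * Y ω + R ω) ∧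
    -- (a), first bound, for the right tail and for the left tail
    (∀ t, 0 < t → μ.real {ω | t ≤ Y ω} ≤
      Real.exp (-(t * (t - 2 * B1 μ Y R lam (1 / c)) / (2 * (V + c * t))))) ∧
    (∀ t, 0 < t → μ.real {ω | Y ω ≤ -t} ≤
      Real.exp (-(t * (t - 2 * B1 μ (-Y) (-R) lam (1 / c)) / (2 * (V + c * t))))) ∧
    -- (a), second bound
    (∀ t, 0 < t → μ.real {ω | t ≤ Y ω} ≤
      Real.exp (-(t * (t - 2 * B1 μ Y R lam (2 / c)) / (10 * V / 3 + c * t)))) ∧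
    (∀ t, 0 < t → μ.real {ω | Y ω ≤ -t} ≤
      Real.exp (-(t * (t - 2 * B1 μ (-Y) (-R) lam (2 / c)) / (10 * V / 3 + c * t)))) ∧
    -- (b), right tail
    (∀ t b, b = B1log μ Y R lam c t → b < t →
      μ.real {ω | t ≤ Y ω} ≤
          Real.exp (-((t - b) / (2 * c) * (Real.log (t - b) - 2 * V / c))) ∧
      (b + Real.exp 1 < t →
        μ.real {ω | t ≤ Y ω} ≤ Real.exp (-((t - b) / c *
          (Real.log (t - b) - Real.log (Real.log (t - b)) - V / c))) ∧
        Real.exp (-((t - b) / c *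
          (Real.log (t - b) - Real.log (Real.log (t - b)) - V / c))) ≤
          Real.exp (-((t - b) / (2 * c) * (Real.log (t - b) - 2 * V / c))))) ∧
    -- (b), left tail
    (∀ t b, b = B1log μ (-Y) (-R) lam c t → b < t →
      μ.real {ω | Y ω ≤ -t} ≤
          Real.exp (-((t - b) / (2 * c) * (Real.log (t - b) - 2 * V / c))) ∧
      (b + Real.exp 1 < t →
        μ.real {ω | Y ω ≤ -t} ≤ Real.exp (-((t - b) / c *
          (Real.log (t - b) - Real.log (Real.log (t - b)) - V / c))) ∧
        Real.exp (-((t - b) / c *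
          (Real.log (t - b) - Real.log (Real.log (t - b)) - V / c))) ≤
          Real.exp (-((t - b) / (2 * c) * (Real.log (t - b) - 2 * V / c))))) ∧
    -- the bounds on the constants, for every range of `s` (both tails)
    (∀ α, B1 μ Y R lam α ≤ (6 * n + 4.8 * θ) * M ∧
      B1 μ (-Y) (-R) lam α ≤ (6 * n + 4.8 * θ) * M) ∧
    B2 μ Y R lam ≤ (3 * kappa1 θ n + 1.2 * θ
      + 1.2 * (kappa1 θ n * (θ + 1) + kappa2 θ n) / n) * M * Real.sqrt (Var[Y; μ]) ∧
    (∀ α, NegCorr μ Y R α → B1 μ Y R lam α ≤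
      θ * M * (3.6 * n + 2.4 * θ - 3) / (θ + n - 1)
        + θ ^ 2 * n * M / (2 * (descPochhammer ℝ 2).eval (θ + n - 1))) ∧
    (∀ α, NegCorr μ (-Y) (-R) α → B1 μ (-Y) (-R) lam α ≤
      θ * M * (3.6 * n + 2.4 * θ - 3) / (θ + n - 1)
        + θ ^ 2 * n * M / (2 * (descPochhammer ℝ 2).eval (θ + n - 1))) := by

  set a := centredArray θ A with ha_def
  have hn2 : 2 ≤ n := by omega
  have hn6 : (6 : ℝ) ≤ n := by exact_mod_cast hn
  have hone := hπ.sum_eq_one hθ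
  have hp : ∀ σ : Equiv.Perm (Fin n), 0 ≤ ewensProb θ σ := fun σ => (ewensProb_pos hθ σ).le
  have hmean : ∫ ω, hoeffding A (π ω) ∂μ = n * meanEntry θ A := by
    rw [hπ.integral_comp hθ (hoeffding A), mean_hoeffding hone hθ hn2]
  have hYS : ∀ ω, Y ω = hoeffding a (π ω) := fun ω => by
    rw [hY, ha_def, hoeffding_centredArray, hmean]
  have hYS' : Y = fun ω => hoeffding a (π ω) := funext hYS
  have ha : ∀ i j, a i j = a j i := fun i j => by simp only [ha_def, centredArray, hA i j]
  have h0 : θ * ∑ i, a i i + ∑ i, ∑ j with j ≠ i, a i j = 0 := centredArray_mean_zero hθ hn2 A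
  have hMa : ∀ i j, |a i j| ≤ M := fun i j => hM ▸ abs_centredArray_le θ A i j
  have hM0 : 0 ≤ M := (abs_nonneg _).trans (hMa ⟨0, by omega⟩ ⟨0, by omega⟩)
  have hYm : Measurable Y := hYS' ▸ hπ.measurable_comp _
  have hcomap : MeasurableSpace.comap Y inferInstance ≤ (inferInstance : MeasurableSpace Ω) :=
    hYm.comap_le
  have hYint : Integrable Y μ := hYS' ▸ hπ.integrable_comp _
  -- If `M` vanished, `Y` would be identically zero, against the positive variance.
  have hMpos : 0 < M := by
    refine lt_of_le_of_ne hM0 fun h => hvar.ne' ?_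
    have hY0 : Y = fun _ => 0 := by
      funext ω
      rw [hYS, hoeffding]
      exact Finset.sum_eq_zero fun i _ => abs_nonpos_iff.1 ((hMa _ _).trans h.ge)
    rw [hY0]
    exact variance_zero μ
  have hcpos : 0 < c := by rw [hc]; positivity
  have hlampos : 0 < lam := by rw [hlam]; positivity
  have hVpos : 0 < V := by
    rw [hV]
    have : 0 ≤ B2 μ Y R lam := div_nonneg (abs_nonneg _) hlampos.le
    linarith
  have hEY : ∫ ω, Y ω ∂μ = 0 := by
    rw [hY, integral_sub (hπ.integrable_comp _) (integrable_const _)]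
    simp
  have hvarY : Var[Y; μ] = ∫ ω, Y ω ^ 2 ∂μ := variance_of_integral_eq_zero hYm.aemeasurable hEY
  have hvarS : Var[Y; μ] = ∑ σ, ewensProb θ σ * hoeffding a σ ^ 2 := by
    rw [hvarY, hYS']; exact hπ.integral_comp hθ fun σ => hoeffding a σ ^ 2
  set Tπ : Ω → ℝ := fun ω => remainderT θ a (π ω) with hTπ
  have hTint : Integrable Tπ μ := hπ.integrable_comp _
  have hTle : ∀ σ, |remainderT θ a σ| ≤ M * (8 * (n - 1) * numFixed σ + 4 * θ * n) :=
    abs_remainderT_le hθ hn2 hMa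
  have hTle' : ∀ σ, |remainderT θ a σ| ≤ M * (8 * (n - 1) * n + 4 * θ * n) := fun σ => by
    refine (hTle σ).trans ?_
    have : (numFixed σ : ℝ) ≤ n := by
      have h := Finset.card_le_univ (Finset.univ.filter fun i => σ i = i)
      rw [Fintype.card_fin] at h
      exact_mod_cast h
    have h1 : (0 : ℝ) ≤ n - 1 := by linarith
    gcongr
  have hnn : (0 : ℝ) < n * (n - 1) := by nlinarith
  have hRe : ∀ ω, R ω = (μ[Tπ | MeasurableSpace.comap Y inferInstance]) ω / (n * (n - 1)) :=
    fun ω => by rw [hR]; rfl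
  have hRe' : R = fun ω => (μ[Tπ | MeasurableSpace.comap Y inferInstance]) ω / (n * (n - 1)) :=
    funext hRe
  have hRint : Integrable R μ := hRe' ▸ integrable_condExp.div_const _
  have hRK : ∀ᵐ ω ∂μ, |R ω| ≤ M * (8 * (n - 1) * n + 4 * θ * n) / (n * (n - 1)) := by
    have h1 := ae_bdd_abs_condExp_of_ae_bdd_abs (m := MeasurableSpace.comap Y inferInstance)
      (μ := μ) (f := Tπ) (ae_of_all _ fun ω => hTle' (π ω))
    filter_upwards [h1] with ω hω
    rw [hRe, abs_div, abs_of_pos hnn]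
    exact div_le_div_of_nonneg_right hω hnn.le
  have hRY : ∀ g : ℝ → ℝ, Measurable g → ∫ ω, R ω * g (Y ω) ∂μ =
      (∑ σ, ewensProb θ σ * (remainderT θ a σ * g (hoeffding a σ))) / (n * (n - 1)) := by
    intro g hg
    have h1 := integral_condExp_mul hYm hTint (stronglyMeasurable_comap_comp (Y := Y) hg)
      (C := ∑ σ, |g (hoeffding a σ)|) fun ω => by
        rw [hYS]; exact abs_comp_le_sum (fun σ => g (hoeffding a σ)) ω
    simp only [hRe, div_mul_eq_mul_div]
    rw [integral_div, h1]
    congr 1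
    simp only [hTπ, hYS]
    exact hπ.integral_comp hθ fun σ => remainderT θ a σ * g (hoeffding a σ)
  have hright : SteinBound μ Y R lam c V := by
    rw [hlam, hc]
    exact hπ.steinBound hθ hn2 ha h0 hMa hM0 hYS hRint ⟨_, hRK⟩ hRY
      (by rw [hV, hvarY, B2, hlam])
  have hleft : SteinBound μ (-Y) (-R) lam c V := by
    rw [hlam, hc]
    refine hπ.steinBound (a := -a) hθ hn2 (fun i j => congrArg Neg.neg (ha i j)) ?_
      (fun i j => by rw [Matrix.neg_apply, abs_neg]; exact hMa i j) hM0
      (fun ω => by rw [hoeffding_neg, Pi.neg_apply, hYS]) hRint.neg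
      ⟨_, hRK.mono fun ω hω => by rw [Pi.neg_apply, abs_neg]; exact hω⟩ (fun g hg => ?_) ?_
    · simp only [Matrix.neg_apply, Finset.sum_neg_distrib]
      linarith
    · have h1 := hRY (fun y => g (-y)) (hg.comp measurable_neg)
      simp only [Pi.neg_apply, neg_mul, integral_neg, h1, hoeffding_neg, remainderT_neg, mul_neg,
        Finset.sum_neg_distrib, neg_div]
    · simp only [Pi.neg_apply, neg_mul_neg, neg_sq]
      rw [hV, hvarY, B2, hlam]
  have hset : ∀ t, {ω | Y ω ≤ -t} = {ω | t ≤ (-Y) ω} := fun t => by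
    ext ω
    exact le_neg (a := Y ω) (b := t)
  have hdivlam : ∀ x : ℝ, x / (n * (n - 1)) / lam = x / (4 * (n - 1)) := by
    intro x
    have : (n : ℝ) - 1 ≠ 0 := by linarith
    rw [hlam]
    field_simp
  have hq : (0 : ℝ) < 4 * (n - 1) := by linarith
  have hB1 : M * (8 * (n - 1) * n + 4 * θ * n) / (n * (n - 1)) / lam ≤ (6 * n + 4.8 * θ) * M := by
    rw [hdivlam, div_le_iff₀ hq]
    have h1 : 8 * ((n : ℝ) - 1) * n + 4 * θ * n ≤ (6 * n + 4.8 * θ) * (4 * (n - 1)) := by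
      nlinarith
    nlinarith
  have hd2 : 0 < θ + n - 1 := by linarith
  have hER : (∫ ω, |R ω| ∂μ) / lam ≤ θ * M * (3.6 * n + 2.4 * θ - 3) / (θ + n - 1)
      + θ ^ 2 * n * M / (2 * (descPochhammer ℝ 2).eval (θ + n - 1)) := by
    have h1 : ∫ ω, |R ω| ∂μ ≤ (∑ σ, ewensProb θ σ * |remainderT θ a σ|) / (n * (n - 1)) := by
      simp only [hRe, abs_div, abs_of_pos hnn]
      rw [integral_div]
      refine div_le_div_of_nonneg_right ?_ hnn.le
      refine (integral_abs_condExp_le Tπ).trans_eq ?_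
      exact hπ.integral_comp hθ fun σ => |remainderT θ a σ|
    have h2 : ∑ σ, ewensProb θ σ * |remainderT θ a σ| ≤
        M * (8 * (n - 1) * (θ * n / (θ + n - 1)) + 4 * θ * n) := by
      refine (Finset.sum_le_sum fun σ _ => mul_le_mul_of_nonneg_left (hTle σ) (hp σ)).trans_eq ?_
      rw [← mean_numFixed hone hθ hn2]
      have h3 : ∀ σ : Equiv.Perm (Fin n), ewensProb θ σ *
          (M * (8 * (n - 1) * numFixed σ + 4 * θ * n)) =
          M * (8 * (n - 1) * (ewensProb θ σ * numFixed σ) + 4 * θ * n * ewensProb θ σ) :=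
        fun σ => by ring
      simp only [h3, ← Finset.mul_sum, Finset.sum_add_distrib, hone, mul_one]
    have h4 : (∫ ω, |R ω| ∂μ) / lam ≤
        M * (8 * (n - 1) * (θ * n / (θ + n - 1)) + 4 * θ * n) / (4 * (n - 1)) := by
      rw [← hdivlam]
      exact div_le_div_of_nonneg_right (h1.trans (div_le_div_of_nonneg_right h2 hnn.le)) hlampos.le
    refine h4.trans ?_
    -- The mean of the linear bound on `|T|` already lies below the first summand of the claim, so
    -- the second need only be nonnegative.
    have h5 : 0 ≤ θ ^ 2 * n * M / (2 * (descPochhammer ℝ 2).eval (θ + n - 1)) := by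
      have : (descPochhammer ℝ 2).eval (θ + n - 1) = (θ + n - 1) * (θ + n - 1 - 1) := by
        simp [descPochhammer_succ_right]
      rw [this]
      have : 0 < θ + n - 1 - 1 := by linarith
      positivity
    refine le_add_of_le_of_nonneg ?_ h5
    have e1 : M * (8 * (n - 1) * (θ * n / (θ + n - 1)) + 4 * θ * n) / (4 * (n - 1)) =
        θ * M * (2 * n + n / (n - 1) * (θ + n - 1)) / (θ + n - 1) := by
      have : (n : ℝ) - 1 ≠ 0 := by linarith
      field_simp
      ring
    rw [e1]
    refine div_le_div_of_nonneg_right (mul_le_mul_of_nonneg_left ?_ (by positivity)) hd2.le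
    -- Equality holds at `n = 6`; this is the source of the constant `1.2`.
    have h6 : (n : ℝ) / (n - 1) ≤ 1.2 := by
      rw [div_le_iff₀ (by linarith)]
      linarith
    have h7 := mul_le_mul_of_nonneg_right h6 hd2.le
    norm_num at h7 ⊢
    linarith
  have hB2 : B2 μ Y R lam ≤ (3 * kappa1 θ n + 1.2 * θ
      + 1.2 * (kappa1 θ n * (θ + 1) + kappa2 θ n) / n) * M * Real.sqrt (Var[Y; μ]) := by
    set sd := Real.sqrt (Var[Y; μ]) with hsd
    have hk1 : 0 ≤ kappa1 θ n := Real.sqrt_nonneg _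
    have hk2 : 0 ≤ kappa2 θ n := Real.sqrt_nonneg _
    have h1 := hRY (fun y => y) measurable_id
    -- Cauchy–Schwarz, where `kappa1` is the root mean square of the number of fixed points.
    have hS1 : ∑ σ, ewensProb θ σ * (|hoeffding a σ| * (numFixed σ : ℝ)) ≤ sd * kappa1 θ n := by
      have := sum_weight_mul_mul_le hp (fun σ => |hoeffding a σ|) (fun σ => (numFixed σ : ℝ))
      simp only [sq_abs] at this
      rwa [mean_numFixed_sq hone hθ hn2, Real.sqrt_sq hk1, ← hvarS] at this
    have hS2 : ∑ σ, ewensProb θ σ * |hoeffding a σ| ≤ sd := by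
      have := sum_weight_mul_mul_le hp (fun σ => |hoeffding a σ|) (fun _ => 1)
      simp only [sq_abs, one_pow, mul_one, hone, Real.sqrt_one] at this
      rwa [← hvarS] at this
    have h2 : |∑ σ, ewensProb θ σ * (remainderT θ a σ * hoeffding a σ)| ≤
        M * (8 * (n - 1) * (sd * kappa1 θ n) + 4 * θ * n * sd) := by
      refine (Finset.abs_sum_le_sum_abs _ _).trans ?_
      have h3 : ∀ σ, |ewensProb θ σ * (remainderT θ a σ * hoeffding a σ)| ≤
          M * (8 * (n - 1) * (ewensProb θ σ * (|hoeffding a σ| * numFixed σ)) +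
            4 * θ * n * (ewensProb θ σ * |hoeffding a σ|)) := fun σ => by
        rw [abs_mul, abs_mul, abs_of_nonneg (hp σ)]
        have := mul_le_mul_of_nonneg_left (mul_le_mul_of_nonneg_right (hTle σ)
          (abs_nonneg (hoeffding a σ))) (hp σ)
        refine this.trans_eq ?_
        ring
      refine (Finset.sum_le_sum fun σ _ => h3 σ).trans ?_
      simp only [← Finset.mul_sum, Finset.sum_add_distrib]
      have : (0 : ℝ) ≤ n - 1 := by linarith
      gcongr
    have h4 : B2 μ Y R lam ≤
        M * (8 * (n - 1) * (sd * kappa1 θ n) + 4 * θ * n * sd) / (4 * (n - 1)) := by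
      rw [B2, ← hdivlam]
      simp only [mul_comm (Y _)]
      rw [h1, abs_div, abs_of_pos hnn]
      exact div_le_div_of_nonneg_right (div_le_div_of_nonneg_right h2 hnn.le) hlampos.le
    refine h4.trans ?_
    have hsd0 : 0 ≤ sd := Real.sqrt_nonneg _
    have e1 : M * (8 * (n - 1) * (sd * kappa1 θ n) + 4 * θ * n * sd) / (4 * (n - 1)) =
        (2 * kappa1 θ n + θ * (n / (n - 1))) * M * sd := by
      have : (n : ℝ) - 1 ≠ 0 := by linarith
      field_simp
      ring
    rw [e1]
    have h6 : (n : ℝ) / (n - 1) ≤ 1.2 := by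
      rw [div_le_iff₀ (by linarith)]
      linarith
    have h7 := mul_le_mul_of_nonneg_left h6 hθ.le
    -- The sharper `(2κ₁ + θ n/(n-1)) M σ` has been reached, so the term with `kappa2` enters only
    -- through its sign.
    have h8 : 0 ≤ 1.2 * (kappa1 θ n * (θ + 1) + kappa2 θ n) / n := by positivity
    refine mul_le_mul_of_nonneg_right (mul_le_mul_of_nonneg_right ?_ hM0) hsd0
    linarith
  refine ⟨?_, fun t ht => hright.measure_ge_le hlampos hcpos hVpos ht,
    fun t ht => hset t ▸ hleft.measure_ge_le hlampos hcpos hVpos ht,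
    fun t ht => hright.measure_ge_le' hlampos hcpos hVpos ht,
    fun t ht => hset t ▸ hleft.measure_ge_le' hlampos hcpos hVpos ht,
    fun t b hb hbt => hright.measure_ge_le_log hlampos hcpos hVpos hb hbt,
    fun t b hb hbt => hset t ▸ hleft.measure_ge_le_log hlampos hcpos hVpos hb hbt,
    fun α => ⟨(B1_le_of_ae_abs_le hlampos hRint hRK α).trans hB1,
      (B1_le_of_ae_abs_le hlampos hRint.neg
        (hRK.mono fun ω hω => by rw [Pi.neg_apply, abs_neg]; exact hω) α).trans hB1⟩,
    hB2, fun α hα => ?_, fun α hα => ?_⟩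
  · have hpt : (fun ω => conjMean A (π ω) - ∫ ω', hoeffding A (π ω') ∂μ) =
        fun ω => ((1 - lam) • Y) ω + ((n * (n - 1) : ℝ)⁻¹ • Tπ) ω := by
      funext ω
      have h1 := sum_hoeffding_conj_swap ha h0 (π ω)
      simp only [ha_def, hoeffding_centredArray, Finset.sum_sub_distrib] at h1
      have hcard : ∑ i : Fin n, ∑ j : Fin n with j ≠ i, (n * meanEntry θ A) =
          n * (n - 1) * (n * meanEntry θ A) := by
        simp only [Finset.filter_ne', Finset.sum_const,
          Finset.card_erase_of_mem (Finset.mem_univ _), Finset.card_univ, Fintype.card_fin,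
          nsmul_eq_mul]
        rw [Nat.cast_pred (by omega)]
        ring
      rw [hcard, sub_eq_iff_eq_add] at h1
      rw [conjMean, h1, hmean]
      simp only [Pi.smul_apply, smul_eq_mul, hYS, hTπ, ha_def, hoeffding_centredArray, hlam]
      have : (n : ℝ) - 1 ≠ 0 := by linarith
      have : (n : ℝ) ≠ 0 := by linarith
      field_simp
      ring
    rw [hpt]
    have h2 := condExp_add (hYint.smul (1 - lam)) (hTint.smul (n * (n - 1) : ℝ)⁻¹)
      (MeasurableSpace.comap Y inferInstance)
    have h3 := condExp_smul (μ := μ) (n * (n - 1) : ℝ)⁻¹ Tπ (MeasurableSpace.comap Y inferInstance)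
    -- The drift identity holds pointwise in `π`; conditioning on `Y` fixes its linear part and
    -- turns `T` into `R`.
    have h4 : μ[(1 - lam) • Y | MeasurableSpace.comap Y inferInstance] = (1 - lam) • Y :=
      condExp_of_stronglyMeasurable hcomap
        ((comap_measurable Y).stronglyMeasurable.const_smul _) (hYint.smul _)
    filter_upwards [h2, h3] with ω hω2 hω3
    refine hω2.trans ?_
    rw [Pi.add_apply, hω3, h4, hRe]
    simp only [Pi.smul_apply, smul_eq_mul]
    ring
  · rw [B1, if_pos hα]
    exact hER
  · rw [B1, if_pos hα]
    simp only [Pi.neg_apply, abs_neg]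
    exact hER
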